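/- Let $\Omega\subset\mathbb R^n$ be a bounded domain (open connected set) of class $C^3$ which is uniformly convex, i.e. there is a radius $R>0$ such that $\Omega\subset B_R(x_0+R\,\nu_{x_0})$ for every $x_0\in\partial\Omega$, where $\nu_{x_0}$ is the interior unit normal to $\partial\Omega$ at $x_0$. Let $\lambda>0$ and $K\ge 0$. Then there is a constant $C$, depending only on $\Omega$, $\lambda$ and $K$, with the following property. If $f\in C^2(\overline\Omega)$ satisfies $\lambda\le f\le 1/\lambda$ in $\Omega$ and $\|f\|_{C^2(\overline\Omega)}\le K$, and if $u\in C^2(\overline\Omega)$ is a convex solution of $$\det D^2u=f\ \text{ in }\Omega,\qquad u=0\ \text{ on }\partial\Omega,$$ then $$\|D^2u\|_{C^0(\overline\Omega)}\le C .$$ -/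

import Mathlib

open scoped ENNReal Gradient

/-- `ρ` is a local defining function of class `C^k` of the open set `Ω` at the boundary point `x₀`:
near `x₀` the set `Ω` is `{ρ > 0}`, and the gradient of `ρ` at `x₀` does not vanish. -/
def IsLocalDefiningFunction {n : ℕ} (k : ℕ) (Ω : Set (EuclideanSpace ℝ (Fin n)))
    (x₀ : EuclideanSpace ℝ (Fin n)) (ρ : EuclideanSpace ℝ (Fin n) → ℝ) : Prop :=
  ∃ U : Set (EuclideanSpace ℝ (Fin n)), IsOpen U ∧ x₀ ∈ U ∧ ContDiffOn ℝ k ρ U ∧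
    ∇ ρ x₀ ≠ 0 ∧ Ω ∩ U = {x ∈ U | 0 < ρ x}

/-- The open set `Ω` is of class `C^k` (`k ≥ 1`). By the implicit function theorem this is the same
as saying that near each boundary point, after a rotation, `Ω` is the region above the graph of
a `C^k` function. -/
def IsOfClassC {n : ℕ} (k : ℕ) (Ω : Set (EuclideanSpace ℝ (Fin n))) : Prop :=
  ∀ x₀ ∈ frontier Ω, ∃ ρ : EuclideanSpace ℝ (Fin n) → ℝ, IsLocalDefiningFunction k Ω x₀ ρ

/-- `ν` is the interior unit normal to `Ω` at the boundary point `x₀`. -/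
def IsInteriorNormal {n : ℕ} (Ω : Set (EuclideanSpace ℝ (Fin n)))
    (x₀ ν : EuclideanSpace ℝ (Fin n)) : Prop :=
  ∃ ρ : EuclideanSpace ℝ (Fin n) → ℝ, IsLocalDefiningFunction 1 Ω x₀ ρ ∧
    ν = ‖∇ ρ x₀‖⁻¹ • ∇ ρ x₀

/-- Uniform convexity of a set `Ω` with (at least) `C¹` boundary: for one radius `R`, at each
boundary point `x₀` the set `Ω` is contained in the ball of radius `R` which touches it at `x₀` from
outside, i.e. the ball centred at `x₀ + R ν`, with `ν` the interior unit normal at `x₀`. -/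
def IsUniformlyConvexDomain {n : ℕ} (Ω : Set (EuclideanSpace ℝ (Fin n))) : Prop :=
  ∃ R : ℝ, 0 < R ∧ ∀ x₀ ∈ frontier Ω, ∀ ν : EuclideanSpace ℝ (Fin n),
    IsInteriorNormal Ω x₀ ν → Ω ⊆ Metric.ball (x₀ + R • ν) R

/-- The Hessian matrix of the second partial derivatives of `u` at `x`. -/
noncomputable def hessianMatrix {n : ℕ} (u : EuclideanSpace ℝ (Fin n) → ℝ)
    (x : EuclideanSpace ℝ (Fin n)) : Matrix (Fin n) (Fin n) ℝ :=
  Matrix.of fun i j =>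
    iteratedFDeriv ℝ 2 u x ![EuclideanSpace.single i 1, EuclideanSpace.single j 1]

/-- `‖D^k g‖_{C⁰(closure Ω)}`, the supremum over the closure of `Ω` of the operator norm of the
`k`-th derivative (at boundary points: the derivative relative to the closure of `Ω`, which is the
continuous extension of the derivative from the interior). It is `∞` if unbounded. -/
noncomputable def supNormDeriv {n : ℕ} (k : ℕ) (Ω : Set (EuclideanSpace ℝ (Fin n)))
    (g : EuclideanSpace ℝ (Fin n) → ℝ) : ℝ≥0∞ :=
  ⨆ x ∈ closure Ω, ‖iteratedFDerivWithin ℝ k g (closure Ω) x‖ₑ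

/-- `‖g‖_{C²(closure Ω)}`, as the sum of the `C⁰` norms of `g`, `Dg` and `D²g`. -/
noncomputable def normC2 {n : ℕ} (Ω : Set (EuclideanSpace ℝ (Fin n)))
    (g : EuclideanSpace ℝ (Fin n) → ℝ) : ℝ≥0∞ :=
  supNormDeriv 0 Ω g + supNormDeriv 1 Ω g + supNormDeriv 2 Ω g

/-- `u` is a (classical, convex) solution of the Dirichlet problem `det D²u = f` in `Ω`,
`u = 0` on the boundary of `Ω`. Its regularity is `C²` up to the boundary. -/
structure IsMongeAmpereSolution {n : ℕ} (Ω : Set (EuclideanSpace ℝ (Fin n)))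
    (f u : EuclideanSpace ℝ (Fin n) → ℝ) : Prop where
  contDiffOn : ContDiffOn ℝ 2 u (closure Ω)
  convexOn : ConvexOn ℝ (closure Ω) u
  det_eq : ∀ x ∈ Ω, (hessianMatrix u x).det = f x
  eq_zero : ∀ x ∈ frontier Ω, u x = 0

/-!
The estimate follows from the maximum principle, applied only to `u` itself, to its composition
with affine maps and to symmetric second differences of `u`. Nothing beyond second derivatives of
`u` is ever used, so that no regularity theory is needed: wherever the classical argument
differentiates the equation, the monotonicity and the log-concavity of the determinant on positive
definite matrices (`Matrix.PosSemidef.det_le_det`, `Matrix.PosDef.det_mul_det_le_sq_det_midpoint`)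
are applied to the Hessians at two or three different points.

*Size of `u` and of its normal derivative.* Paraboloids vanishing on the sphere which encloses the
domain and touches it at a boundary point, and on a sphere inside the domain, are barriers
(`neg_le_of_subset_ball`, `le_of_closedBall_subset`). They bound the normal derivative at the
boundary from both sides, away from zero.

*Tangential derivatives near the boundary.* Let `ν` be the interior normal at the boundary point
`x₀` and `τ` a tangent vector. For a suitable `q ⟂ ν` the maps
`x ↦ x + t (τ - ⟨q, x - x₀⟩ ν)` are unimodular, so that the composition of `u` with them solves an
equation of the same form, with a right hand side which differs from `f` by `O(t)`; and they move
the boundary along itself up to an error `O(t |x - x₀|²) + O(t ⟨ν, x - x₀⟩) + O(t²)`. This is where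
the third derivatives of the boundary enter. By uniform convexity
`|x - x₀|² ≤ 2 R ⟨ν, x - x₀⟩` in the domain, so that the part of first order in `t` is dominated by
a *linear* function of `x`, and the paraboloid `a |x - x₀|² - b ⟨ν, x - x₀⟩` is a barrier in the
whole domain. The result (`exists_apply_shearField_le`) says that the derivative of `u` along the
field generating the maps is at most `A ⟨ν, x - x₀⟩`.

*Second derivatives at the boundary.* Following that bound along rays from `x₀` gives the mixed
second derivatives, and shows that the tangential ones are the normal derivative times the curvature
of the boundary (`boundary_two_apply`), hence bounded and bounded away from zero. The equation then
bounds the remaining, normal one (`apply_self_le_of_det_le`).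

*Second derivatives in the interior.* The symmetric second difference of `u` with step `h`, plus
`M h² |x - p|²`, has no interior maximum if `M` is large, because the determinant is log-concave and
the second differences of `f` are `O(h²)`. Its maximum is thus within `h` of the boundary, where the
uniform continuity of `D²u` compares it with the bound at the boundary (`two_apply_le`).
-/

-- needed to find the norm instances on spaces of bilinear forms
set_option maxSynthPendingDepth 3

/-! ### Determinants of symmetric matrices -/

/-- A positive definite matrix and a symmetric one are simultaneously diagonalized by a
congruence. -/
lemma Matrix.PosDef.exists_simultaneous_congruence {ι : Type*} [Fintype ι] [DecidableEq ι]
    {A B : Matrix ι ι ℝ} (hA : A.PosDef) (hB : B.IsHermitian) :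
    ∃ (X : Matrix ι ι ℝ) (d : ι → ℝ), IsUnit X ∧ A = star X * X ∧
      B = star X * Matrix.diagonal d * X := by
  obtain ⟨Y, hY⟩ : ∃ Y : Matrix ι ι ℝ, A = star Y * Y := by
    open scoped MatrixOrder in
    exact CStarAlgebra.nonneg_iff_eq_star_mul_self.1 (Matrix.nonneg_iff_posSemidef.2 hA.posSemidef)
  have hYu : IsUnit Y := by
    rw [Matrix.isUnit_iff_isUnit_det, isUnit_iff_ne_zero]
    intro h
    have := hA.det_pos
    rw [hY, Matrix.det_mul, h, mul_zero] at this
    exact lt_irrefl _ this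
  have hYd : IsUnit Y.det := (Matrix.isUnit_iff_isUnit_det _).1 hYu
  have hY1 : Y⁻¹ * Y = 1 := Matrix.nonsing_inv_mul _ hYd
  have hY2 : star Y * star Y⁻¹ = 1 := by rw [← star_mul, hY1, star_one]
  set C := star Y⁻¹ * B * Y⁻¹ with hC
  have hCh : C.IsHermitian := by
    rw [hC]
    exact Matrix.isHermitian_conjTranspose_mul_mul _ hB
  set U : Matrix ι ι ℝ := (hCh.eigenvectorUnitary : Matrix ι ι ℝ) with hU
  have hUs : C = U * Matrix.diagonal hCh.eigenvalues * star U := by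
    have := hCh.spectral_theorem
    simpa [Unitary.conjStarAlgAut_apply, hU, Function.comp_def] using this
  have hUU : U * star U = 1 := Unitary.mul_star_self_of_mem hCh.eigenvectorUnitary.2
  have hUU' : star U * U = 1 := Unitary.star_mul_self_of_mem hCh.eigenvectorUnitary.2
  refine ⟨star U * Y, hCh.eigenvalues, ?_, ?_, ?_⟩
  · exact IsUnit.mul ⟨⟨star U, U, hUU', hUU⟩, rfl⟩ hYu
  · rw [star_mul, star_star, hY]
    calc star Y * Y = star Y * (U * star U) * Y := by rw [hUU, mul_one]
      _ = _ := by simp only [mul_assoc]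
  · rw [star_mul, star_star]
    calc B = (star Y * star Y⁻¹) * B * (Y⁻¹ * Y) := by rw [hY1, hY2, one_mul, mul_one]
      _ = star Y * C * Y := by rw [hC]; simp only [mul_assoc]
      _ = star Y * (U * Matrix.diagonal hCh.eigenvalues * star U) * Y :=
        congrArg (fun M => star Y * M * Y) hUs
      _ = _ := by simp only [mul_assoc]

section
variable {ι : Type*} [Fintype ι] [DecidableEq ι]

lemma Matrix.det_star_mul_diagonal_mul (X : Matrix ι ι ℝ) (d : ι → ℝ) :
    (star X * Matrix.diagonal d * X).det = X.det ^ 2 * ∏ i, d i := by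
  rw [Matrix.det_mul, Matrix.det_mul, Matrix.det_diagonal, Matrix.star_eq_conjTranspose,
    Matrix.det_conjTranspose, star_trivial]
  ring

lemma Matrix.PosSemidef.det_le_det {A B : Matrix ι ι ℝ} (hA : A.PosSemidef)
    (hAB : (B - A).PosSemidef) : A.det ≤ B.det := by
  have hB : B.PosSemidef := by simpa using hA.add hAB
  by_cases h : A.det = 0
  · rw [h]; exact hB.det_nonneg
  obtain ⟨X, d, hX, hA', hB'⟩ :=
    ((hA.posDef_iff_det_ne_zero).2 h).exists_simultaneous_congruence hB.1
  have hA'' : A = star X * Matrix.diagonal (fun _ => 1) * X := by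
    rw [hA', Matrix.diagonal_one, mul_one]
  have h1 : B - A = star X * Matrix.diagonal (fun i => d i - 1) * X := by
    rw [hB', hA'', ← sub_mul, ← mul_sub, Matrix.diagonal_sub]
  rw [h1, Matrix.IsUnit.posSemidef_star_left_conjugate_iff hX,
    Matrix.posSemidef_diagonal_iff] at hAB
  rw [hA'', hB', Matrix.det_star_mul_diagonal_mul, Matrix.det_star_mul_diagonal_mul]
  refine mul_le_mul_of_nonneg_left (Finset.prod_le_prod (by simp) fun i _ => ?_) (sq_nonneg _)
  have := hAB i
  linarith

/-- The determinant strictly increases along the identity, at a rate which is controlled from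
below as long as the determinant itself is bounded: the smallest eigenvalue is then bounded. -/
lemma Matrix.PosDef.det_mul_le_det_add_smul_one [Nonempty ι] {A : Matrix ι ι ℝ} (hA : A.PosDef)
    {lam s : ℝ} (hlam : 0 < lam) (hlam1 : lam ≤ 1) (hdet : A.det ≤ 1 / lam) (hs : 0 ≤ s) :
    A.det * (1 + s * lam) ≤ (A + s • (1 : Matrix ι ι ℝ)).det := by
  obtain ⟨X, d, hX, h1, hA'⟩ :=
    (Matrix.PosDef.one (n := ι) (R := ℝ)).exists_simultaneous_congruence hA.1
  have hdetX : X.det ^ 2 = 1 := by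
    have := congrArg Matrix.det h1
    rw [Matrix.det_one, Matrix.det_mul, Matrix.star_eq_conjTranspose, Matrix.det_conjTranspose,
      star_trivial] at this
    rw [this]; ring
  have hsum : A + s • (1 : Matrix ι ι ℝ) = star X * Matrix.diagonal (fun i => d i + s) * X := by
    have : Matrix.diagonal (fun i => d i + s) = Matrix.diagonal d + s • (1 : Matrix ι ι ℝ) := by
      rw [← Matrix.diagonal_one, ← Matrix.diagonal_smul, Matrix.diagonal_add]
      simp
    rw [this, mul_add, add_mul, ← hA', mul_smul_comm, mul_one, smul_mul_assoc, ← h1]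
  have hd : ∀ i, 0 < d i := by
    have := hA
    rw [hA', Matrix.IsUnit.posDef_star_left_conjugate_iff hX, Matrix.posDef_diagonal_iff] at this
    exact this
  have hA'' : A.det = ∏ i, d i := by
    rw [hA', Matrix.det_star_mul_diagonal_mul, hdetX, one_mul]
  rw [hsum, Matrix.det_star_mul_diagonal_mul, hdetX, one_mul, hA'']
  rw [hA''] at hdet
  obtain ⟨j, hj⟩ : ∃ j, d j ≤ 1 / lam := by
    by_contra! hcon
    have h1l : 1 ≤ 1 / lam := by rw [le_div_iff₀ hlam]; linarith
    obtain ⟨j⟩ := ‹Nonempty ι›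
    have : d j ≤ ∏ i, d i := by
      rw [← Finset.mul_prod_erase _ _ (Finset.mem_univ j)]
      refine le_mul_of_one_le_right (hd j).le ?_
      calc (1 : ℝ) = ∏ i ∈ Finset.univ.erase j, 1 := by simp
        _ ≤ _ := Finset.prod_le_prod (by simp) fun i _ => h1l.trans (hcon i).le
    linarith [hcon j]
  rw [← Finset.mul_prod_erase _ _ (Finset.mem_univ j),
    ← Finset.mul_prod_erase _ (fun i => d i + s) (Finset.mem_univ j)]
  have hP : 0 < ∏ x ∈ Finset.univ.erase j, d x := Finset.prod_pos fun i _ => hd i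
  have hle : ∏ x ∈ Finset.univ.erase j, d x ≤ ∏ x ∈ Finset.univ.erase j, (d x + s) :=
    Finset.prod_le_prod (fun i _ => (hd i).le) fun i _ => by linarith
  have hjl : d j * lam ≤ 1 := by rwa [le_div_iff₀ hlam] at hj
  calc d j * (∏ x ∈ Finset.univ.erase j, d x) * (1 + s * lam)
      = (d j + s * (d j * lam)) * ∏ x ∈ Finset.univ.erase j, d x := by ring
    _ ≤ (d j + s) * ∏ x ∈ Finset.univ.erase j, d x := by
        refine mul_le_mul_of_nonneg_right ?_ hP.le
        nlinarith
    _ ≤ _ := mul_le_mul_of_nonneg_left hle (by linarith [hd j])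

/-- Midpoint log-concavity of the determinant on positive definite matrices. -/
lemma Matrix.PosDef.det_mul_det_le_sq_det_midpoint {A B : Matrix ι ι ℝ} (hA : A.PosDef)
    (hB : B.PosDef) : A.det * B.det ≤ ((2⁻¹ : ℝ) • (A + B)).det ^ 2 := by
  obtain ⟨X, d, hX, hA', hB'⟩ := hA.exists_simultaneous_congruence hB.1
  have hA'' : A = star X * Matrix.diagonal (fun _ => 1) * X := by
    rw [hA', Matrix.diagonal_one, mul_one]
  have hd : ∀ i, 0 < d i := by
    have := hB
    rw [hB', Matrix.IsUnit.posDef_star_left_conjugate_iff hX, Matrix.posDef_diagonal_iff] at this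
    exact this
  have hmid : (2⁻¹ : ℝ) • (A + B) = star X * Matrix.diagonal (fun i => 2⁻¹ * (1 + d i)) * X := by
    have : Matrix.diagonal (fun i => 2⁻¹ * (1 + d i)) =
        (2⁻¹ : ℝ) • (Matrix.diagonal (fun _ => 1) + Matrix.diagonal d) := by
      rw [Matrix.diagonal_add, ← Matrix.diagonal_smul]
      rfl
    rw [this, mul_smul_comm, smul_mul_assoc, mul_add, add_mul, ← hA'', ← hB']
  rw [hmid, hA'', hB', Matrix.det_star_mul_diagonal_mul, Matrix.det_star_mul_diagonal_mul,
    Matrix.det_star_mul_diagonal_mul, Finset.prod_const_one, mul_pow, ← Finset.prod_pow]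
  have : ∏ i, d i ≤ ∏ i, (2⁻¹ * (1 + d i)) ^ 2 :=
    Finset.prod_le_prod (fun i _ => (hd i).le) fun i _ => by nlinarith [sq_nonneg (1 - d i)]
  calc X.det ^ 2 * 1 * (X.det ^ 2 * ∏ i, d i) = (X.det ^ 2) ^ 2 * ∏ i, d i := by ring
    _ ≤ _ := mul_le_mul_of_nonneg_left this (sq_nonneg _)

lemma Matrix.det_smul_one_add_smul_vecMulVec (a b : ℝ) (v : ι → ℝ) (ha : a ≠ 0)
    (hv : v ⬝ᵥ v = 1) :
    (a • (1 : Matrix ι ι ℝ) + b • Matrix.vecMulVec v v).det =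
      a ^ Fintype.card ι * (1 + b / a) := by
  have : a • (1 : Matrix ι ι ℝ) + b • Matrix.vecMulVec v v =
      a • (1 + Matrix.replicateCol Unit ((b / a) • v) * Matrix.replicateRow Unit v) := by
    rw [← Matrix.vecMulVec_eq, Matrix.smul_vecMulVec, smul_add, smul_smul, mul_div_cancel₀ _ ha]
  rw [this, Matrix.det_smul, Matrix.det_one_add_replicateCol_mul_replicateRow,
    dotProduct_smul, hv, smul_eq_mul, mul_one]

end

/-! ### Second order Taylor expansion and second differences -/

section
open Filter Topology Set
variable {E : Type*} [NormedAddCommGroup E] [NormedSpace ℝ E] {S : Set E} {u : E → ℝ}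
  {D1 : E → E →L[ℝ] ℝ} {D2 : E → E →L[ℝ] E →L[ℝ] ℝ}

lemma norm_fderiv_sub_sub_le (hS : Convex ℝ S)
    (h2 : ∀ x ∈ S, HasFDerivWithinAt D1 (D2 x) S x) {x v : E} (hx : x ∈ S) (hxv : x + v ∈ S)
    {B : E →L[ℝ] E →L[ℝ] ℝ} {ε : ℝ} (hB : ∀ z ∈ segment ℝ x (x + v), ‖D2 z - B‖ ≤ ε) :
    ‖D1 (x + v) - D1 x - B v‖ ≤ ε * ‖v‖ := by
  have hT : segment ℝ x (x + v) ⊆ S := hS.segment_subset hx hxv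
  have := (convex_segment x (x + v)).norm_image_sub_le_of_norm_hasFDerivWithin_le'
    (fun z hz => (h2 z (hT hz)).mono hT) hB (left_mem_segment ℝ _ _) (right_mem_segment ℝ _ _)
  simpa using this

/-- Second order Taylor expansion on a convex set, at points which may lie on its boundary, with
an error controlled by the oscillation of the second derivative. -/
lemma abs_taylor_two_le (hS : Convex ℝ S) (h1 : ∀ x ∈ S, HasFDerivWithinAt u (D1 x) S x)
    (h2 : ∀ x ∈ S, HasFDerivWithinAt D1 (D2 x) S x) {x v : E} (hx : x ∈ S) (hxv : x + v ∈ S)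
    {B : E →L[ℝ] E →L[ℝ] ℝ} {ε : ℝ} (hB : ∀ z ∈ segment ℝ x (x + v), ‖D2 z - B‖ ≤ ε) :
    |u (x + v) - u x - D1 x v - 2⁻¹ * B v v| ≤ ε * ‖v‖ ^ 2 := by
  have hT : segment ℝ x (x + v) ⊆ S := hS.segment_subset hx hxv
  have hε : 0 ≤ ε := (norm_nonneg (D2 x - B)).trans (hB x (left_mem_segment ℝ _ _))
  have hmem : ∀ s ∈ Icc (0 : ℝ) 1, x + s • v ∈ segment ℝ x (x + v) := by
    intro s hs
    rw [segment_eq_image']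
    exact ⟨s, hs, by simp⟩
  have hγ : ∀ s : ℝ, HasDerivAt (fun s : ℝ => x + s • v) v s := fun s => by
    simpa using ((hasDerivAt_id s).smul_const v).const_add x
  have hψ : ∀ s ∈ Icc (0 : ℝ) 1, HasDerivWithinAt
      (fun s : ℝ => u (x + s • v) - s * D1 x v - s ^ 2 * (2⁻¹ * B v v))
      (D1 (x + s • v) v - D1 x v - s * B v v) (Icc 0 1) s := by
    intro s hs
    have e1 : HasDerivWithinAt (fun s : ℝ => u (x + s • v)) (D1 (x + s • v) v) (Icc 0 1) s :=
      (h1 _ (hT (hmem s hs))).comp_hasDerivWithinAt s (hγ s).hasDerivWithinAt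
        fun r hr => hT (hmem r hr)
    have e2 : HasDerivAt (fun s : ℝ => s * D1 x v) (D1 x v) s := by
      simpa using (hasDerivAt_id s).mul_const (D1 x v)
    have e3 : HasDerivAt (fun s : ℝ => s ^ 2 * (2⁻¹ * B v v)) (s * B v v) s := by
      refine ((hasDerivAt_pow 2 s).mul_const (2⁻¹ * B v v)).congr_deriv ?_
      simp; ring
    exact (e1.sub e2.hasDerivWithinAt).sub e3.hasDerivWithinAt
  have hb : ∀ s ∈ Ico (0 : ℝ) 1, ‖D1 (x + s • v) v - D1 x v - s * B v v‖ ≤ ε * ‖v‖ ^ 2 := by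
    intro s hs
    have hs' : s ∈ Icc (0 : ℝ) 1 := ⟨hs.1, hs.2.le⟩
    have hsub : segment ℝ x (x + s • v) ⊆ segment ℝ x (x + v) :=
      (convex_segment _ _).segment_subset (left_mem_segment ℝ _ _) (hmem s hs')
    have h := norm_fderiv_sub_sub_le hS h2 hx (hT (hmem s hs')) fun z hz => hB z (hsub hz)
    have h' := (D1 (x + s • v) - D1 x - B (s • v)).le_of_opNorm_le h v
    have hsv : ‖s • v‖ ≤ ‖v‖ := by
      rw [norm_smul, Real.norm_of_nonneg hs.1]
      exact mul_le_of_le_one_left (norm_nonneg _) hs.2.le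
    have e : (D1 (x + s • v) - D1 x - B (s • v)) v = D1 (x + s • v) v - D1 x v - s * B v v := by
      simp
    rw [e] at h'
    refine h'.trans ?_
    nlinarith [mul_le_mul_of_nonneg_left hsv (mul_nonneg hε (norm_nonneg v))]
  have := norm_image_sub_le_of_norm_deriv_le_segment_01' hψ hb
  simp only [one_smul, zero_smul, Real.norm_eq_abs] at this
  convert this using 2
  simp
  ring

/-- Bounds a symmetric second difference by the second derivative. -/
lemma abs_second_difference_sub_le (hS : Convex ℝ S)
    (h1 : ∀ x ∈ S, HasFDerivWithinAt u (D1 x) S x)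
    (h2 : ∀ x ∈ S, HasFDerivWithinAt D1 (D2 x) S x) {x v : E} (hx : x ∈ S) (hxv : x + v ∈ S)
    (hxv' : x - v ∈ S) {B : E →L[ℝ] E →L[ℝ] ℝ} {ε : ℝ}
    (hB : ∀ z ∈ S, ‖z - x‖ ≤ ‖v‖ → ‖D2 z - B‖ ≤ ε) :
    |u (x + v) + u (x - v) - 2 * u x - B v v| ≤ 2 * ε * ‖v‖ ^ 2 := by
  have key : ∀ w, ‖w‖ = ‖v‖ → x + w ∈ S → ∀ z ∈ segment ℝ x (x + w), ‖D2 z - B‖ ≤ ε := by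
    intro w hw hxw z hz
    refine hB z (hS.segment_subset hx hxw hz) ?_
    rw [← hw]
    simpa using norm_sub_le_of_mem_segment hz
  rw [sub_eq_add_neg] at hxv'
  have a := abs_taylor_two_le hS h1 h2 hx hxv (key v rfl hxv)
  have b := abs_taylor_two_le hS h1 h2 hx hxv' (key (-v) (norm_neg v) hxv')
  rw [norm_neg] at b
  simp only [map_neg, _root_.neg_apply, neg_neg, ← sub_eq_add_neg] at b
  rw [abs_le] at a b ⊢
  constructor <;> linarith [a.1, a.2, b.1, b.2]

/-- The symmetric second difference quotients of a `C²` function converge to its second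
derivative. -/
lemma tendsto_second_difference (hS : Convex ℝ S)
    (h1 : ∀ x ∈ S, HasFDerivWithinAt u (D1 x) S x)
    (h2 : ∀ x ∈ S, HasFDerivWithinAt D1 (D2 x) S x) (hc : ContinuousOn D2 S) {x : E}
    (hx : S ∈ 𝓝 x) (v : E) :
    Tendsto (fun t : ℝ => (u (x + t • v) + u (x - t • v) - 2 * u x) / t ^ 2) (𝓝[>] 0)
      (𝓝 (D2 x v v)) := by
  rw [Metric.tendsto_nhds]
  intro η hη
  set ε := η / (4 * (‖v‖ ^ 2 + 1)) with hε
  have hεpos : 0 < ε := by positivity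
  have hcx : ∀ᶠ z in 𝓝 x, z ∈ S ∧ ‖D2 z - D2 x‖ ≤ ε := by
    have : ContinuousAt D2 x := hc.continuousAt hx
    have h : ∀ᶠ z in 𝓝 x, dist (D2 z) (D2 x) < ε :=
      this (Metric.ball_mem_nhds (D2 x) hεpos)
    filter_upwards [h, hx] with z hz hz'
    exact ⟨hz', (dist_eq_norm (D2 z) (D2 x)).symm.trans_le hz.le⟩
  obtain ⟨δ, hδ, hball⟩ := Metric.eventually_nhds_iff.1 hcx
  have hsmall : ∀ᶠ t : ℝ in 𝓝[>] 0, t * ‖v‖ < δ := by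
    have : Tendsto (fun t : ℝ => t * ‖v‖) (𝓝[>] 0) (𝓝 0) := by
      have : Tendsto (fun t : ℝ => t * ‖v‖) (𝓝 0) (𝓝 (0 * ‖v‖)) := tendsto_id.mul_const _
      rw [zero_mul] at this
      exact this.mono_left nhdsWithin_le_nhds
    exact this.eventually_lt_const hδ
  filter_upwards [hsmall, self_mem_nhdsWithin] with t ht ht0
  have ht0' : 0 < t := ht0
  have hn : ‖t • v‖ = t * ‖v‖ := by rw [norm_smul, Real.norm_of_nonneg ht0'.le]
  have m1 : x + t • v ∈ S := (hball (by simp [dist_eq_norm, ← hn] at ht ⊢; exact ht)).1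
  have m2 : x - t • v ∈ S := (hball (by simp [← hn] at ht ⊢; exact ht)).1
  have := abs_second_difference_sub_le hS h1 h2 (mem_of_mem_nhds hx) m1 m2 (B := D2 x) (ε := ε)
    fun z _ hz' => (hball (by rw [dist_eq_norm]; linarith [hn ▸ hz'])).2
  rw [hn] at this
  have e : (u (x + t • v) + u (x - t • v) - 2 * u x) / t ^ 2 - D2 x v v =
      (u (x + t • v) + u (x - t • v) - 2 * u x - D2 x (t • v) (t • v)) / t ^ 2 := by
    simp only [map_smul, _root_.smul_apply, smul_eq_mul]
    field_simp
  rw [Real.dist_eq, e, abs_div, abs_of_pos (by positivity : 0 < t ^ 2), div_lt_iff₀ (by positivity)]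
  refine this.trans_lt ?_
  have h4 : ε * (4 * (‖v‖ ^ 2 + 1)) = η := by rw [hε]; field_simp
  have ht2 : 0 < t ^ 2 := by positivity
  rw [← h4]
  nlinarith [mul_pos hεpos ht2, mul_nonneg (mul_pos hεpos ht2).le (sq_nonneg ‖v‖)]

end

/-! ### Boundary charts with uniform constants -/

section
open Filter Topology Set Metric
variable {n : ℕ}

/-- `ρ` is a defining function of `Ω` in the ball of radius `δ` about the boundary point `x₀`,
normalized so that its gradient at `x₀` is the unit vector `ν`. The functions `ρ₁`, `ρ₂` are its
first and second derivatives; the second one is bounded by `N`, and so is its Lipschitz constant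
at `x₀`. -/
structure IsBoundaryChart (Ω : Set (EuclideanSpace ℝ (Fin n))) (x₀ ν : EuclideanSpace ℝ (Fin n))
    (ρ : EuclideanSpace ℝ (Fin n) → ℝ)
    (ρ₁ : EuclideanSpace ℝ (Fin n) → EuclideanSpace ℝ (Fin n) →L[ℝ] ℝ)
    (ρ₂ : EuclideanSpace ℝ (Fin n) →
      EuclideanSpace ℝ (Fin n) →L[ℝ] EuclideanSpace ℝ (Fin n) →L[ℝ] ℝ) (δ N : ℝ) : Prop where
  norm_normal : ‖ν‖ = 1
  fderiv_center : ∀ w, ρ₁ x₀ w = inner ℝ ν w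
  eq_zero : ρ x₀ = 0
  hasFDerivAt : ∀ x ∈ ball x₀ δ, HasFDerivAt ρ (ρ₁ x) x
  hasFDerivAt_two : ∀ x ∈ ball x₀ δ, HasFDerivAt ρ₁ (ρ₂ x) x
  norm_two_le : ∀ x ∈ ball x₀ δ, ‖ρ₂ x‖ ≤ N
  norm_two_sub_le : ∀ x ∈ ball x₀ δ, ‖ρ₂ x - ρ₂ x₀‖ ≤ N * ‖x - x₀‖
  mem_iff : ∀ x ∈ ball x₀ δ, x ∈ Ω ↔ 0 < ρ x

lemma IsBoundaryChart.mono {Ω : Set (EuclideanSpace ℝ (Fin n))} {x₀ ν ρ ρ₁ ρ₂} {δ N δ' N' : ℝ}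
    (h : IsBoundaryChart Ω x₀ ν ρ ρ₁ ρ₂ δ N) (hδ : δ' ≤ δ) (hN : N ≤ N') :
    IsBoundaryChart Ω x₀ ν ρ ρ₁ ρ₂ δ' N' :=
  have hb : ball x₀ δ' ⊆ ball x₀ δ := ball_subset_ball hδ
  { norm_normal := h.norm_normal
    fderiv_center := h.fderiv_center
    eq_zero := h.eq_zero
    hasFDerivAt := fun x hx => h.hasFDerivAt x (hb hx)
    hasFDerivAt_two := fun x hx => h.hasFDerivAt_two x (hb hx)
    norm_two_le := fun x hx => (h.norm_two_le x (hb hx)).trans hN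
    norm_two_sub_le := fun x hx => (h.norm_two_sub_le x (hb hx)).trans
      (mul_le_mul_of_nonneg_right hN (norm_nonneg _))
    mem_iff := fun x hx => h.mem_iff x (hb hx) }

/-- A `C³` function is locally, with its derivatives, bounded in the way needed for a chart. -/
lemma exists_ball_fderiv_bounds {E : Type*} [NormedAddCommGroup E] [NormedSpace ℝ E] {U : Set E}
    (hU : IsOpen U) {x₁ : E} (hx₁ : x₁ ∈ U) {ρ : E → ℝ} (hc : ContDiffOn ℝ 3 ρ U)
    (hg : fderiv ℝ ρ x₁ ≠ 0) :
    ∃ δ c N : ℝ, 0 < δ ∧ 0 < c ∧ 0 < N ∧ ball x₁ δ ⊆ U ∧ (∀ x ∈ ball x₁ δ,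
      HasFDerivAt ρ (fderiv ℝ ρ x) x ∧ HasFDerivAt (fderiv ℝ ρ) (fderiv ℝ (fderiv ℝ ρ) x) x ∧
      c < ‖fderiv ℝ ρ x‖ ∧ ‖fderiv ℝ (fderiv ℝ ρ) x‖ ≤ N ∧
      ∀ y ∈ ball x₁ δ, ‖fderiv ℝ (fderiv ℝ ρ) x - fderiv ℝ (fderiv ℝ ρ) y‖ ≤ N * ‖x - y‖) := by
  have c1 : ContDiffOn ℝ 2 (fderiv ℝ ρ) U := hc.fderiv_of_isOpen hU (by norm_num)
  have c2 : ContDiffOn ℝ 1 (fderiv ℝ (fderiv ℝ ρ)) U := c1.fderiv_of_isOpen hU (by norm_num)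
  have hUx : U ∈ 𝓝 x₁ := hU.mem_nhds hx₁
  have hgpos := norm_pos_iff.2 hg
  obtain ⟨K, t, ht, hLip⟩ := (c2.contDiffAt hUx).exists_lipschitzOnWith
  set N : ℝ := ‖fderiv ℝ (fderiv ℝ ρ) x₁‖ + K + 1 with hN
  have e1 : ∀ᶠ x in 𝓝 x₁, ‖fderiv ℝ ρ x₁‖ / 2 < ‖fderiv ℝ ρ x‖ :=
    (c1.continuousOn.continuousAt hUx).norm.eventually_const_lt (by linarith)
  have e2 : ∀ᶠ x in 𝓝 x₁, ‖fderiv ℝ (fderiv ℝ ρ) x‖ < N := by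
    have h := (c2.continuousOn.continuousAt hUx).norm
    exact h.eventually_lt_const (by have := K.2; rw [hN]; linarith [NNReal.coe_nonneg K])
  obtain ⟨δ, hδ, hball⟩ := Metric.eventually_nhds_iff_ball.1
    (((hU.eventually_mem hx₁).and e1).and (e2.and ht))
  refine ⟨δ, _, N, hδ, half_pos hgpos, by positivity, fun x hx => (hball x hx).1.1,
    fun x hx => ⟨?_, ?_, (hball x hx).1.2, (hball x hx).2.1.le, fun y hy => ?_⟩⟩
  · exact ((hc.differentiableOn (by norm_num)).differentiableAt
      (hU.mem_nhds (hball x hx).1.1)).hasFDerivAt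
  · exact ((c1.differentiableOn (by norm_num)).differentiableAt
      (hU.mem_nhds (hball x hx).1.1)).hasFDerivAt
  · refine (hLip.norm_sub_le (hball x hx).2.2 (hball y hy).2.2).trans ?_
    refine mul_le_mul_of_nonneg_right ?_ (norm_nonneg _)
    rw [hN]
    linarith [norm_nonneg (fderiv ℝ (fderiv ℝ ρ) x₁)]

lemma exists_chart_near {Ω : Set (EuclideanSpace ℝ (Fin n))} (hΩ : IsOpen Ω)
    {x₁ : EuclideanSpace ℝ (Fin n)} {ρ : EuclideanSpace ℝ (Fin n) → ℝ}
    (hρ : IsLocalDefiningFunction 3 Ω x₁ ρ) :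
    ∃ δ N : ℝ, 0 < δ ∧ 0 < N ∧ ∀ x₀ ∈ ball x₁ δ ∩ frontier Ω, ∃ ν ρ' ρ₁ ρ₂,
      IsInteriorNormal Ω x₀ ν ∧ IsBoundaryChart Ω x₀ ν ρ' ρ₁ ρ₂ δ N := by
  obtain ⟨U, hU, hxU, hc, hg, hdef⟩ := hρ
  have hg1 : fderiv ℝ ρ x₁ ≠ 0 := fun h => hg (by simp [gradient, h])
  obtain ⟨δ, c, N₀, hδ, hcpos, hN₀pos, hballU, hball⟩ := exists_ball_fderiv_bounds hU hxU hc hg1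
  refine ⟨δ / 2, N₀ / c, by positivity, by positivity, ?_⟩
  rintro x₀ ⟨hx₀, hx₀f⟩
  have hsub : ball x₀ (δ / 2) ⊆ ball x₁ δ := by
    refine ball_subset_ball' ?_
    have := mem_ball.1 hx₀
    linarith
  have hx₀δ : x₀ ∈ ball x₁ δ := hsub (mem_ball_self (by positivity))
  have hx₀U : x₀ ∈ U := hballU hx₀δ
  have hgnorm : ‖∇ ρ x₀‖ = ‖fderiv ℝ ρ x₀‖ := by simp [gradient]
  have hcn : c < ‖∇ ρ x₀‖ := by rw [hgnorm]; exact (hball x₀ hx₀δ).2.2.1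
  have hnpos : 0 < ‖∇ ρ x₀‖ := hcpos.trans hcn
  set a : ℝ := ‖∇ ρ x₀‖⁻¹ with ha
  have hapos : 0 < a := inv_pos.2 hnpos
  have hac : a ≤ c⁻¹ := inv_anti₀ hcpos hcn.le
  have hmem : ∀ x ∈ U, x ∈ Ω ↔ 0 < ρ x := by
    intro x hx
    have := Set.ext_iff.1 hdef x
    simp only [mem_inter_iff, mem_ofPred_eq, hx, and_true, true_and] at this
    exact this
  have hx₀Ω : x₀ ∉ Ω := fun h => by
    rw [hΩ.frontier_eq] at hx₀f
    exact hx₀f.2 h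
  have hzero : ρ x₀ = 0 := by
    apply le_antisymm (not_lt.1 fun h => hx₀Ω ((hmem x₀ hx₀U).2 h))
    by_contra! hneg
    have h1 : ∀ᶠ x in 𝓝 x₀, ρ x < 0 ∧ x ∈ U :=
      ((hball x₀ hx₀δ).1.continuousAt.eventually_lt_const hneg).and (hU.eventually_mem hx₀U)
    obtain ⟨x, hxΩ, hx, hx'⟩ :=
      ((mem_closure_iff_frequently.1 (frontier_subset_closure hx₀f)).and_eventually h1).exists
    linarith [(hmem x hx').1 hxΩ]
  refine ⟨a • ∇ ρ x₀, fun x => a • ρ x, fun x => a • fderiv ℝ ρ x,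
    fun x => a • fderiv ℝ (fderiv ℝ ρ) x, ⟨ρ, ⟨U, hU, hx₀U, hc.of_le (by norm_num),
      norm_pos_iff.1 hnpos, hdef⟩, rfl⟩, ?_⟩
  have hscale : ∀ r s : ℝ, 0 ≤ s → r ≤ N₀ * s → a * r ≤ N₀ / c * s := by
    intro r s hs hrs
    calc a * r ≤ a * (N₀ * s) := mul_le_mul_of_nonneg_left hrs hapos.le
      _ ≤ c⁻¹ * (N₀ * s) := mul_le_mul_of_nonneg_right hac (by positivity)
      _ = _ := by field_simp
  constructor
  · rw [norm_smul, Real.norm_of_nonneg hapos.le, ha, inv_mul_cancel₀ hnpos.ne']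
  · intro w
    simp [gradient, inner_smul_left]
  · simp [hzero]
  · exact fun x hx => (hball x (hsub hx)).1.const_smul a
  · exact fun x hx => (hball x (hsub hx)).2.1.const_smul a
  · intro x hx
    rw [norm_smul, Real.norm_of_nonneg hapos.le]
    simpa using hscale _ 1 zero_le_one (by simpa using (hball x (hsub hx)).2.2.2.1)
  · intro x hx
    rw [← smul_sub, norm_smul, Real.norm_of_nonneg hapos.le]
    exact hscale _ _ (norm_nonneg _) ((hball x (hsub hx)).2.2.2.2 x₀ hx₀δ)
  · intro x hx
    rw [hmem x (hballU (hsub hx)), smul_eq_mul, mul_pos_iff_of_pos_left hapos]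

/-- On a bounded domain of class `C³` there are boundary charts of a uniform size, with uniform
bounds, at all boundary points. -/
lemma exists_uniform_charts {Ω : Set (EuclideanSpace ℝ (Fin n))} (hΩ : IsOpen Ω)
    (hb : Bornology.IsBounded Ω) (h3 : IsOfClassC 3 Ω) :
    ∃ δ N : ℝ, 0 < δ ∧ 0 < N ∧ ∀ x₀ ∈ frontier Ω, ∃ ν ρ ρ₁ ρ₂,
      IsInteriorNormal Ω x₀ ν ∧ IsBoundaryChart Ω x₀ ν ρ ρ₁ ρ₂ δ N := by
  have hK : IsCompact (frontier Ω) :=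
    hb.isCompact_closure.of_isClosed_subset isClosed_frontier frontier_subset_closure
  suffices H : ∃ δ N : ℝ, 0 < δ ∧ 0 < N ∧ ∀ x₀ ∈ frontier Ω ∩ frontier Ω, ∃ ν ρ ρ₁ ρ₂,
      IsInteriorNormal Ω x₀ ν ∧ IsBoundaryChart Ω x₀ ν ρ ρ₁ ρ₂ δ N by simpa using H
  refine hK.induction_on (p := fun s => ∃ δ N : ℝ, 0 < δ ∧ 0 < N ∧ ∀ x₀ ∈ s ∩ frontier Ω,
      ∃ ν ρ ρ₁ ρ₂, IsInteriorNormal Ω x₀ ν ∧ IsBoundaryChart Ω x₀ ν ρ ρ₁ ρ₂ δ N) ?_ ?_ ?_ ?_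
  · exact ⟨1, 1, one_pos, one_pos, by simp⟩
  · rintro s t hst ⟨δ, N, hδ, hN, h⟩
    exact ⟨δ, N, hδ, hN, fun x hx => h x ⟨hst hx.1, hx.2⟩⟩
  · rintro s t ⟨δ, N, hδ, hN, h⟩ ⟨δ', N', hδ', hN', h'⟩
    refine ⟨min δ δ', max N N', lt_min hδ hδ', lt_max_of_lt_left hN, ?_⟩
    rintro x ⟨hx | hx, hxf⟩
    · obtain ⟨ν, ρ, ρ₁, ρ₂, hn, hc⟩ := h x ⟨hx, hxf⟩
      exact ⟨ν, ρ, ρ₁, ρ₂, hn, hc.mono (min_le_left _ _) (le_max_left _ _)⟩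
    · obtain ⟨ν, ρ, ρ₁, ρ₂, hn, hc⟩ := h' x ⟨hx, hxf⟩
      exact ⟨ν, ρ, ρ₁, ρ₂, hn, hc.mono (min_le_right _ _) (le_max_right _ _)⟩
  · intro x hx
    obtain ⟨ρ, hρ⟩ := h3 x hx
    obtain ⟨δ, N, hδ, hN, h⟩ := exists_chart_near hΩ hρ
    exact ⟨ball x δ, mem_nhdsWithin_of_mem_nhds (ball_mem_nhds x hδ), δ, N, hδ, hN, h⟩

/-- If the ball of radius `R` touching `Ω` at `x₀` contains `Ω`, then the height above the tangent
plane at `x₀` dominates the square of the distance to `x₀`. -/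
lemma sq_norm_sub_le_of_subset_ball {Ω : Set (EuclideanSpace ℝ (Fin n))}
    {x₀ ν : EuclideanSpace ℝ (Fin n)} {R : ℝ} (hν : ‖ν‖ = 1) (hR : 0 < R)
    (hΩR : Ω ⊆ ball (x₀ + R • ν) R) {x : EuclideanSpace ℝ (Fin n)} (hx : x ∈ closure Ω) :
    ‖x - x₀‖ ^ 2 ≤ 2 * R * inner ℝ ν (x - x₀) := by
  have h1 : x ∈ closedBall (x₀ + R • ν) R :=
    closure_minimal (hΩR.trans ball_subset_closedBall) isClosed_closedBall hx
  rw [mem_closedBall, dist_eq_norm] at h1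
  have h2 : ‖x - (x₀ + R • ν)‖ ^ 2 ≤ R ^ 2 := pow_le_pow_left₀ (norm_nonneg _) h1 2
  have e : x - (x₀ + R • ν) = (x - x₀) - R • ν := by abel
  rw [e, norm_sub_sq_real, norm_smul, hν, inner_smul_right, real_inner_comm,
    Real.norm_of_nonneg hR.le] at h2
  linarith

lemma IsBoundaryChart.eventually_mem {Ω : Set (EuclideanSpace ℝ (Fin n))} {x₀ ν ρ ρ₁ ρ₂}
    {δ N : ℝ} (h : IsBoundaryChart Ω x₀ ν ρ ρ₁ ρ₂ δ N) (hδ : 0 < δ)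
    {y : EuclideanSpace ℝ (Fin n)} (hy : 0 < inner ℝ ν y) :
    ∀ᶠ ε : ℝ in 𝓝[>] 0, x₀ + ε • y ∈ Ω := by
  have hd : HasDerivAt (fun ε : ℝ => ρ (x₀ + ε • y)) (inner ℝ ν y) 0 := by
    have hγ : HasDerivAt (fun s : ℝ => x₀ + s • y) y 0 := by
      simpa using ((hasDerivAt_id (0 : ℝ)).smul_const y).const_add x₀
    have h1 : HasFDerivAt ρ (ρ₁ x₀) (x₀ + (0 : ℝ) • y) := by
      simpa using h.hasFDerivAt x₀ (mem_ball_self hδ)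
    have := h1.comp_hasDerivAt (0 : ℝ) hγ
    rwa [h.fderiv_center] at this
  have hpos : ∀ᶠ ε : ℝ in 𝓝[>] 0, 0 < ρ (x₀ + ε • y) := by
    have h2 := (hasDerivAt_iff_tendsto_slope.1 hd).mono_left
      (nhdsWithin_mono 0 (fun t (ht : (0 : ℝ) < t) => ht.ne'))
    filter_upwards [h2.eventually_const_lt hy, self_mem_nhdsWithin] with ε hε h0
    have h0' : (0 : ℝ) < ε := h0
    simp only [slope_def_field, zero_smul, add_zero, h.eq_zero, sub_zero] at hε
    exact (div_pos_iff_of_pos_right h0').1 hε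
  have hball : ∀ᶠ ε : ℝ in 𝓝[>] 0, x₀ + ε • y ∈ ball x₀ δ := by
    have : ContinuousAt (fun ε : ℝ => x₀ + ε • y) 0 := by fun_prop
    have h3 := this (by simpa using ball_mem_nhds x₀ hδ : ball x₀ δ ∈ 𝓝 (x₀ + (0 : ℝ) • y))
    exact mem_nhdsWithin_of_mem_nhds h3
  filter_upwards [hpos, hball] with ε h1 h2
  exact (h.mem_iff _ h2).2 h1

end

/-! ### Curvature of the boundary and the adapted shears -/

section
open Filter Topology Set Metric
variable {n : ℕ}

/-- Uniform convexity bounds the second fundamental form of the boundary from below. -/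
lemma IsBoundaryChart.two_apply_le {Ω : Set (EuclideanSpace ℝ (Fin n))} {x₀ ν ρ ρ₁ ρ₂}
    {δ N R : ℝ} (h : IsBoundaryChart Ω x₀ ν ρ ρ₁ ρ₂ δ N) (hδ : 0 < δ) (hN : 0 < N) (hR : 0 < R)
    (hΩR : Ω ⊆ ball (x₀ + R • ν) R) {τ : EuclideanSpace ℝ (Fin n)} (hτ : ‖τ‖ = 1)
    (hντ : inner ℝ ν τ = 0) : ρ₂ x₀ τ τ ≤ -(1 / R) := by
  by_contra! hcon
  set a := ρ₂ x₀ τ τ with ha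
  -- a parabola tangent to the boundary, curved between `ρ = 0` and the ball of radius `R`
  set k : ℝ := (1 / R - a) / 2 with hk
  have hka : 0 < k + a := by rw [hk]; linarith
  have hkR : k * R < 1 := by
    have : k < 1 / R := by rw [hk]; linarith
    rwa [lt_div_iff₀ hR] at this
  set M : ℝ := N * (|k| + k ^ 2) + N * (1 + |k|) ^ 3 with hM
  have hM0 : 0 ≤ M := by positivity
  obtain ⟨t, ht0, ht1, htδ, htM⟩ : ∃ t : ℝ, 0 < t ∧ t ≤ 1 ∧ t * (1 + |k|) < δ ∧
      t * M < (k + a) / 2 := by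
    have c1 : Tendsto (fun t : ℝ => t * (1 + |k|)) (𝓝[>] 0) (𝓝 0) := by
      have : Tendsto (fun t : ℝ => t * (1 + |k|)) (𝓝 0) (𝓝 (0 * (1 + |k|))) :=
        tendsto_id.mul_const _
      rw [zero_mul] at this
      exact this.mono_left nhdsWithin_le_nhds
    have c2 : Tendsto (fun t : ℝ => t * M) (𝓝[>] 0) (𝓝 0) := by
      have : Tendsto (fun t : ℝ => t * M) (𝓝 0) (𝓝 (0 * M)) := tendsto_id.mul_const _
      rw [zero_mul] at this
      exact this.mono_left nhdsWithin_le_nhds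
    have c3 : ∀ᶠ t : ℝ in 𝓝[>] 0, t ≤ 1 :=
      mem_nhdsWithin_of_mem_nhds (Iic_mem_nhds one_pos)
    obtain ⟨t, ⟨h1, h2⟩, h3, h4⟩ := (((c1.eventually_lt_const hδ).and
      (c2.eventually_lt_const (half_pos hka))).and (c3.and self_mem_nhdsWithin)).exists
    exact ⟨t, h4, h3, h1, h2⟩
  set w : EuclideanSpace ℝ (Fin n) := t • τ + (k * t ^ 2 / 2) • ν with hw
  have hνν : inner ℝ ν ν = (1 : ℝ) := by rw [real_inner_self_eq_norm_sq, h.norm_normal]; norm_num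
  have hνw : inner ℝ ν w = k * t ^ 2 / 2 := by
    rw [hw, inner_add_right, inner_smul_right, inner_smul_right, hντ, hνν]; ring
  have ht2 : t ^ 2 ≤ t := by nlinarith
  have hwn : ‖w‖ ≤ t * (1 + |k|) := by
    refine (norm_add_le _ _).trans ?_
    rw [norm_smul, norm_smul, hτ, h.norm_normal, Real.norm_of_nonneg ht0.le, Real.norm_eq_abs,
      abs_div, abs_mul, abs_of_nonneg (sq_nonneg t), abs_two]
    nlinarith [abs_nonneg k]
  have hwsq : t ^ 2 ≤ ‖w‖ ^ 2 := by
    rw [hw, norm_add_sq_real, inner_smul_left, inner_smul_right, real_inner_comm, hντ, norm_smul,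
      hτ, Real.norm_of_nonneg ht0.le]
    simp only [mul_one, mul_zero, add_zero]
    linarith [sq_nonneg ‖(k * t ^ 2 / 2) • ν‖]
  have hwball : x₀ + w ∈ ball x₀ δ := by
    rw [mem_ball, dist_eq_norm, add_sub_cancel_left]; linarith
  have hx₀ball : x₀ ∈ ball x₀ δ := mem_ball_self hδ
  have hT := abs_taylor_two_le (convex_ball x₀ δ)
    (fun x hx => (h.hasFDerivAt x hx).hasFDerivWithinAt)
    (fun x hx => (h.hasFDerivAt_two x hx).hasFDerivWithinAt) hx₀ball hwball (B := ρ₂ x₀)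
    (ε := N * ‖w‖) (by
      intro z hz
      have hzb := (convex_ball x₀ δ).segment_subset hx₀ball hwball hz
      refine (h.norm_two_sub_le z hzb).trans (mul_le_mul_of_nonneg_left ?_ hN.le)
      simpa using norm_sub_le_of_mem_segment hz)
  rw [h.eq_zero, h.fderiv_center, hνw] at hT
  have hB : ∀ v v' : EuclideanSpace ℝ (Fin n), |ρ₂ x₀ v v'| ≤ N * ‖v‖ * ‖v'‖ := fun v v' => by
    refine ((ρ₂ x₀).le_opNorm₂ v v').trans ?_
    gcongr
    exact h.norm_two_le x₀ hx₀ball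
  have hww : t ^ 2 * a - N * (|k| + k ^ 2) * t ^ 3 ≤ ρ₂ x₀ w w := by
    have e : ρ₂ x₀ w w = t ^ 2 * a + (k * t ^ 3 / 2) * (ρ₂ x₀ τ ν + ρ₂ x₀ ν τ) +
        (k ^ 2 * t ^ 4 / 4) * ρ₂ x₀ ν ν := by
      simp only [hw, map_add, map_smul, _root_.add_apply, _root_.smul_apply, smul_eq_mul, ha]
      ring
    have b1 := hB τ ν
    have b2 := hB ν τ
    have b3 := hB ν ν
    rw [hτ, h.norm_normal] at b1 b2
    rw [h.norm_normal] at b3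
    simp only [mul_one] at b1 b2 b3
    have b12 : |ρ₂ x₀ τ ν + ρ₂ x₀ ν τ| ≤ 2 * N := (abs_add_le _ _).trans (by linarith)
    have c1 : |(k * t ^ 3 / 2) * (ρ₂ x₀ τ ν + ρ₂ x₀ ν τ)| ≤ N * |k| * t ^ 3 := by
      rw [abs_mul, abs_div, abs_mul, abs_of_pos (pow_pos ht0 3), abs_two]
      calc |k| * t ^ 3 / 2 * |ρ₂ x₀ τ ν + ρ₂ x₀ ν τ| ≤ |k| * t ^ 3 / 2 * (2 * N) := by gcongr
        _ = _ := by ring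
    have c2 : |(k ^ 2 * t ^ 4 / 4) * ρ₂ x₀ ν ν| ≤ N * k ^ 2 * t ^ 3 := by
      rw [abs_mul, abs_of_nonneg (by positivity : 0 ≤ k ^ 2 * t ^ 4 / 4)]
      calc k ^ 2 * t ^ 4 / 4 * |ρ₂ x₀ ν ν| ≤ k ^ 2 * t ^ 4 / 4 * N := by gcongr
        _ = (N * k ^ 2 * t ^ 3) * (t / 4) := by ring
        _ ≤ (N * k ^ 2 * t ^ 3) * 1 := by gcongr; linarith
        _ = _ := by ring
    rw [e]
    have := (abs_le.1 c1).1
    have := (abs_le.1 c2).1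
    linarith
  have hw3 : N * ‖w‖ * ‖w‖ ^ 2 ≤ N * (1 + |k|) ^ 3 * t ^ 3 := by
    calc N * ‖w‖ * ‖w‖ ^ 2 = N * ‖w‖ ^ 3 := by ring
      _ ≤ N * (t * (1 + |k|)) ^ 3 := by gcongr
      _ = _ := by ring
  have hρ : 0 < ρ (x₀ + w) := by
    have h1 := (abs_le.1 hT).1
    have h2 : 0 < t ^ 2 * ((k + a) / 2 - t * M) := by
      have := sub_pos.2 htM
      positivity
    have h3 : N * (|k| + k ^ 2) * t ^ 3 = t ^ 2 * (t * (N * (|k| + k ^ 2))) := by ring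
    have h4 : N * (1 + |k|) ^ 3 * t ^ 3 = t ^ 2 * (t * (N * (1 + |k|) ^ 3)) := by ring
    have h5 : 0 ≤ t ^ 2 * (t * (N * (|k| + k ^ 2))) := by positivity
    rw [hM] at h2
    nlinarith
  have hmem : x₀ + w ∈ Ω := (h.mem_iff _ hwball).2 hρ
  have := sq_norm_sub_le_of_subset_ball h.norm_normal hR hΩR (subset_closure hmem)
  rw [add_sub_cancel_left, hνw] at this
  nlinarith [pow_pos ht0 2]

/-- The tangential part of the vector representing `B · τ`. With `B` the second derivative of a
defining function, it measures how the normal turns. -/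
noncomputable def bendVector
    (B : EuclideanSpace ℝ (Fin n) →L[ℝ] EuclideanSpace ℝ (Fin n) →L[ℝ] ℝ)
    (ν τ : EuclideanSpace ℝ (Fin n)) : EuclideanSpace ℝ (Fin n) :=
  (InnerProductSpace.toDual ℝ (EuclideanSpace ℝ (Fin n))).symm (B.flip τ) - B ν τ • ν

lemma inner_bendVector (B : EuclideanSpace ℝ (Fin n) →L[ℝ] EuclideanSpace ℝ (Fin n) →L[ℝ] ℝ)
    (ν τ y : EuclideanSpace ℝ (Fin n)) :
    inner ℝ (bendVector B ν τ) y = B y τ - B ν τ * inner ℝ ν y := by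
  rw [bendVector, inner_sub_left, InnerProductSpace.toDual_symm_apply, inner_smul_left]
  simp

lemma bendVector_neg (B : EuclideanSpace ℝ (Fin n) →L[ℝ] EuclideanSpace ℝ (Fin n) →L[ℝ] ℝ)
    (ν τ : EuclideanSpace ℝ (Fin n)) : bendVector B ν (-τ) = -bendVector B ν τ := by
  refine ext_inner_right ℝ fun y => ?_
  rw [inner_neg_left, inner_bendVector, inner_bendVector]
  simp only [map_neg]
  ring

lemma norm_bendVector_le {B : EuclideanSpace ℝ (Fin n) →L[ℝ] EuclideanSpace ℝ (Fin n) →L[ℝ] ℝ}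
    {ν τ : EuclideanSpace ℝ (Fin n)} {N : ℝ} (hB : ‖B‖ ≤ N) (hν : ‖ν‖ = 1) (hτ : ‖τ‖ = 1) :
    ‖bendVector B ν τ‖ ≤ 2 * N := by
  have h1 : ‖B.flip τ‖ ≤ N := by
    have := B.flip.le_opNorm τ
    rw [ContinuousLinearMap.opNorm_flip, hτ, mul_one] at this
    exact this.trans hB
  have h2 : ‖B ν τ • ν‖ ≤ N := by
    rw [norm_smul, hν, mul_one]
    have := B.le_opNorm₂ ν τ
    rw [hν, hτ, mul_one, mul_one] at this
    exact this.trans hB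
  refine (norm_sub_le _ _).trans ?_
  rw [LinearIsometryEquiv.norm_map]
  linarith

/-- The affine vector field generating the shears `x ↦ x + t V(x)`, which are unimodular if
`q ⟂ ν`. If `q` is the bending vector of a boundary chart at `x₀` in the tangential direction `τ`,
this field is tangent to the boundary at `x₀` to first order. -/
noncomputable def shearField (x₀ ν τ q x : EuclideanSpace ℝ (Fin n)) : EuclideanSpace ℝ (Fin n) :=
  τ - inner ℝ q (x - x₀) • ν

lemma norm_shearField_le {x₀ ν τ q x : EuclideanSpace ℝ (Fin n)} {N d : ℝ} (hN : 0 ≤ N)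
    (hν : ‖ν‖ = 1) (hτ : ‖τ‖ = 1) (hq : ‖q‖ ≤ 2 * N) (hx : ‖x - x₀‖ ≤ d) :
    ‖shearField x₀ ν τ q x‖ ≤ 1 + 2 * N * d := by
  refine (norm_sub_le _ _).trans ?_
  rw [hτ, norm_smul, hν, mul_one]
  have := (norm_inner_le_norm (𝕜 := ℝ) q (x - x₀)).trans
    (mul_le_mul hq hx (norm_nonneg _) (by positivity))
  linarith

/-- The derivative of the defining function along the adapted shear field is of second order in
tangential directions. -/
lemma IsBoundaryChart.abs_apply_shearField_le {Ω : Set (EuclideanSpace ℝ (Fin n))}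
    {x₀ ν ρ ρ₁ ρ₂} {δ N : ℝ} (h : IsBoundaryChart Ω x₀ ν ρ ρ₁ ρ₂ δ N) (hδ : 0 < δ) (hN : 0 < N)
    {τ : EuclideanSpace ℝ (Fin n)} (hτ : ‖τ‖ = 1) (hντ : inner ℝ ν τ = 0)
    {x : EuclideanSpace ℝ (Fin n)} (hx : x ∈ ball x₀ δ) :
    |ρ₁ x (shearField x₀ ν τ (bendVector (ρ₂ x₀) ν τ) x)| ≤
      N * |inner ℝ ν (x - x₀)| + (N + 2 * N ^ 2) * ‖x - x₀‖ ^ 2 := by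
  have hx₀ball : x₀ ∈ ball x₀ δ := mem_ball_self hδ
  set y := x - x₀ with hy
  have hxy : x₀ + y = x := by rw [hy]; abel
  have hseg : ∀ z ∈ segment ℝ x₀ (x₀ + y), z ∈ ball x₀ δ ∧ ‖z - x₀‖ ≤ ‖y‖ := fun z hz =>
    ⟨(convex_ball x₀ δ).segment_subset hx₀ball (hxy ▸ hx) hz, by
      simpa using norm_sub_le_of_mem_segment hz⟩
  have e1 := norm_fderiv_sub_sub_le (convex_ball x₀ δ)
    (fun x hx => (h.hasFDerivAt_two x hx).hasFDerivWithinAt) hx₀ball (hxy.symm ▸ hx)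
    (B := ρ₂ x₀) (ε := N * ‖y‖) fun z hz => (h.norm_two_sub_le z (hseg z hz).1).trans
      (mul_le_mul_of_nonneg_left (hseg z hz).2 hN.le)
  have e2 := norm_fderiv_sub_sub_le (convex_ball x₀ δ)
    (fun x hx => (h.hasFDerivAt_two x hx).hasFDerivWithinAt) hx₀ball (hxy.symm ▸ hx)
    (B := 0) (ε := N) fun z hz => by simpa using h.norm_two_le z (hseg z hz).1
  rw [hxy] at e1 e2
  have a1 := (ρ₁ x - ρ₁ x₀ - ρ₂ x₀ y).le_of_opNorm_le e1 τ
  have a2 := (ρ₁ x - ρ₁ x₀ - (0 : EuclideanSpace ℝ (Fin n) →L[ℝ] _) y).le_of_opNorm_le e2 ν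
  have hνν : inner ℝ ν ν = (1 : ℝ) := by rw [real_inner_self_eq_norm_sq, h.norm_normal]; norm_num
  simp only [_root_.sub_apply, _root_.zero_apply, h.fderiv_center, hντ, hνν, hτ, h.norm_normal,
    mul_one, sub_zero, Real.norm_eq_abs] at a1 a2
  have a3 : |ρ₂ x₀ ν τ| ≤ N := by
    have := (ρ₂ x₀).le_opNorm₂ ν τ
    rw [h.norm_normal, hτ, mul_one, mul_one] at this
    exact this.trans (h.norm_two_le x₀ hx₀ball)
  have a4 : |inner ℝ (bendVector (ρ₂ x₀) ν τ) y| ≤ 2 * N * ‖y‖ :=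
    (abs_real_inner_le_norm _ _).trans (mul_le_mul_of_nonneg_right
      (norm_bendVector_le (h.norm_two_le x₀ hx₀ball) h.norm_normal hτ) (norm_nonneg _))
  have e : ρ₁ x (shearField x₀ ν τ (bendVector (ρ₂ x₀) ν τ) x) =
      (ρ₁ x τ - ρ₂ x₀ y τ) + ρ₂ x₀ ν τ * inner ℝ ν y -
        inner ℝ (bendVector (ρ₂ x₀) ν τ) y * (ρ₁ x ν - 1) := by
    rw [shearField, map_sub, map_smul, smul_eq_mul, ← hy, mul_sub, inner_bendVector]
    ring
  rw [e]
  have b1 : |ρ₂ x₀ ν τ * inner ℝ ν y| ≤ N * |inner ℝ ν y| := by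
    rw [abs_mul]; exact mul_le_mul_of_nonneg_right a3 (abs_nonneg _)
  have b2 : |inner ℝ (bendVector (ρ₂ x₀) ν τ) y * (ρ₁ x ν - 1)| ≤ 2 * N ^ 2 * ‖y‖ ^ 2 := by
    rw [abs_mul]
    calc _ ≤ (2 * N * ‖y‖) * (N * ‖y‖) := mul_le_mul a4 a2 (abs_nonneg _) (by positivity)
      _ = _ := by ring
  refine (abs_sub _ _).trans ?_
  have := abs_add_le (ρ₁ x τ - ρ₂ x₀ y τ) (ρ₂ x₀ ν τ * inner ℝ ν y)
  nlinarith

/-- In a small ball of a boundary chart, the distance to the complement is at most twice the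
defining function. -/
lemma IsBoundaryChart.infDist_compl_le {Ω : Set (EuclideanSpace ℝ (Fin n))} {x₀ ν ρ ρ₁ ρ₂}
    {δ N δ' : ℝ} (h : IsBoundaryChart Ω x₀ ν ρ ρ₁ ρ₂ δ N) (hN : 0 < N)
    (hδ' : 0 < δ') (hδδ : δ' ≤ δ) (hNδ : N * δ' ≤ 1 / 2) {x : EuclideanSpace ℝ (Fin n)}
    (hx : ‖x - x₀‖ + infDist x Ωᶜ ≤ δ') : infDist x Ωᶜ ≤ max 0 (2 * ρ x) := by
  have hx₀ball : x₀ ∈ ball x₀ δ := mem_ball_self (hδ'.trans_le hδδ)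
  have hsub : ball x₀ δ' ⊆ ball x₀ δ := ball_subset_ball hδδ
  refine le_of_forall_lt_imp_le_of_dense fun s hs => ?_
  rcases le_or_gt s 0 with hs0 | hs0
  · exact le_max_of_le_left hs0
  refine le_max_of_le_right ?_
  have hxball : x ∈ ball x₀ δ' := by rw [mem_ball, dist_eq_norm]; linarith
  have hdist : dist x (x - s • ν) = s := by
    rw [dist_eq_norm, sub_sub_cancel, norm_smul, h.norm_normal, mul_one, Real.norm_of_nonneg hs0.le]
  have hball2 : x - s • ν ∈ ball x₀ δ' := by
    rw [mem_ball]
    refine (dist_triangle_left _ _ x).trans_lt ?_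
    rw [hdist, dist_eq_norm]
    linarith
  have hΩ : x - s • ν ∈ Ω := by
    by_contra hcon
    have := infDist_le_dist_of_mem (s := Ωᶜ) (x := x) (y := x - s • ν) hcon
    linarith
  have hpos := (h.mem_iff _ (hsub hball2)).1 hΩ
  have hmv := (convex_ball x₀ δ').norm_image_sub_le_of_norm_hasFDerivWithin_le'
    (f := ρ) (f' := ρ₁) (φ := ρ₁ x₀) (C := 1 / 2)
    (fun z hz => (h.hasFDerivAt z (hsub hz)).hasFDerivWithinAt) (by
      intro z hz
      have := (convex_ball x₀ δ).norm_image_sub_le_of_norm_hasFDerivWithin_le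
        (fun z hz => (h.hasFDerivAt_two z hz).hasFDerivWithinAt) h.norm_two_le hx₀ball (hsub hz)
      refine this.trans (le_trans ?_ hNδ)
      have hz' := mem_ball.1 hz
      rw [dist_eq_norm] at hz'
      exact mul_le_mul_of_nonneg_left hz'.le hN.le) hxball hball2
  have hνν : inner ℝ ν ν = (1 : ℝ) := by rw [real_inner_self_eq_norm_sq, h.norm_normal]; norm_num
  have e : x - s • ν - x = -(s • ν) := by abel
  rw [e, norm_neg, norm_smul, h.norm_normal, map_neg, map_smul, h.fderiv_center, hνν,
    Real.norm_of_nonneg hs0.le, Real.norm_eq_abs] at hmv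
  have := (abs_le.1 hmv).2
  simp only [smul_eq_mul, mul_one] at this
  linarith

/-- A point which the adapted shear moves onto the boundary was close to the boundary, up to an
error dominated by the height above the tangent plane at `x₀`. -/
lemma exists_infDist_compl_le_of_shear_mem_frontier {Ω : Set (EuclideanSpace ℝ (Fin n))}
    (hΩ : IsOpen Ω) {δ N R d : ℝ} (hδ : 0 < δ) (hN : 0 < N) (hR : 0 < R) (hd : 0 ≤ d) :
    ∃ C C' t₀ : ℝ, 0 < C ∧ 0 < t₀ ∧ ∀ x₀ ν ρ ρ₁ ρ₂, IsBoundaryChart Ω x₀ ν ρ ρ₁ ρ₂ δ N →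
      Ω ⊆ ball (x₀ + R • ν) R → ∀ τ, ‖τ‖ = 1 → inner ℝ ν τ = 0 → ∀ t, 0 < t → t < t₀ →
      ∀ x ∈ closure Ω, ‖x - x₀‖ ≤ d →
        x + t • shearField x₀ ν τ (bendVector (ρ₂ x₀) ν τ) x ∈ frontier Ω →
        infDist x Ωᶜ ≤ C * t * inner ℝ ν (x - x₀) + C' * t ^ 2 := by
  set δ' := min δ (1 / (2 * N)) with hδ'def
  have hδ' : 0 < δ' := lt_min hδ (by positivity)
  have hδδ : δ' ≤ δ := min_le_left _ _
  have hNδ : N * δ' ≤ 1 / 2 := by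
    calc N * δ' ≤ N * (1 / (2 * N)) := by gcongr; exact min_le_right _ _
      _ = 1 / 2 := by field_simp
  set V : ℝ := 1 + 2 * N * d with hV
  have hVpos : 0 < V := by positivity
  set C₁ : ℝ := 2 * (N + (N + 2 * N ^ 2) * (2 * R)) with hC₁
  set C₂ : ℝ := V * (8 * R / δ' ^ 2) with hC₂
  have hC₁pos : 0 < C₁ := by positivity
  have hC₂pos : 0 < C₂ := by positivity
  refine ⟨C₁ + C₂, 2 * N * V ^ 2, δ' / (2 * V), by positivity, by positivity, ?_⟩
  intro x₀ ν ρ ρ₁ ρ₂ h hΩR τ hτ hντ t ht0 ht x hx hxd hy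
  set q := bendVector (ρ₂ x₀) ν τ with hq
  have hx₀ball : x₀ ∈ ball x₀ δ := mem_ball_self hδ
  have hVx : ‖shearField x₀ ν τ q x‖ ≤ V := norm_shearField_le hN.le h.norm_normal hτ
    (norm_bendVector_le (h.norm_two_le x₀ hx₀ball) h.norm_normal hτ) hxd
  set W := shearField x₀ ν τ q x with hW
  have hyΩ : x + t • W ∉ Ω := fun hmem => by
    rw [hΩ.frontier_eq] at hy
    exact hy.2 hmem
  have htW : ‖t • W‖ ≤ t * V := by
    rw [norm_smul, Real.norm_of_nonneg ht0.le]
    exact mul_le_mul_of_nonneg_left hVx ht0.le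
  have hdle : infDist x Ωᶜ ≤ t * V := by
    refine (infDist_le_dist_of_mem (s := Ωᶜ) (y := x + t • W) hyΩ).trans ?_
    rwa [dist_eq_norm, sub_add_cancel_left, norm_neg]
  have htV : t * V < δ' / 2 := by
    rw [lt_div_iff₀ (by positivity)] at ht
    linarith
  have hsq := sq_norm_sub_le_of_subset_ball h.norm_normal hR hΩR hx
  have hℓ : 0 ≤ inner ℝ ν (x - x₀) := by
    by_contra! hneg
    nlinarith [sq_nonneg ‖x - x₀‖]
  clear_value δ' V q W
  have hNV : 0 ≤ 2 * N * V ^ 2 * t ^ 2 := by positivity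
  rcases le_or_gt (δ' / 2) ‖x - x₀‖ with hfar | hnear
  · -- away from `x₀` the height above the tangent plane is bounded below
    have h1 : δ' ^ 2 ≤ 8 * R * inner ℝ ν (x - x₀) := by nlinarith
    have h2 : 1 ≤ 8 * R / δ' ^ 2 * inner ℝ ν (x - x₀) := by
      rw [div_mul_eq_mul_div, le_div_iff₀ (by positivity)]
      linarith
    have h3 : t * V * 1 ≤ t * V * (8 * R / δ' ^ 2 * inner ℝ ν (x - x₀)) := by gcongr
    have h4 : 0 ≤ C₁ * t * inner ℝ ν (x - x₀) := by positivity
    have h5 : C₂ * t * inner ℝ ν (x - x₀) =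
        t * V * (8 * R / δ' ^ 2 * inner ℝ ν (x - x₀)) := by rw [hC₂]; ring
    linarith
  · have hxb : x ∈ ball x₀ δ := by rw [mem_ball, dist_eq_norm]; linarith
    have hyb : x + t • W ∈ ball x₀ δ := by
      rw [mem_ball, dist_eq_norm]
      have e : x + t • W - x₀ = (x - x₀) + t • W := by abel
      rw [e]
      exact (norm_add_le _ _).trans_lt (by linarith)
    have hρy : ρ (x + t • W) ≤ 0 := not_lt.1 fun hp => hyΩ ((h.mem_iff _ hyb).2 hp)
    have hT := abs_taylor_two_le (convex_ball x₀ δ)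
      (fun x hx => (h.hasFDerivAt x hx).hasFDerivWithinAt)
      (fun x hx => (h.hasFDerivAt_two x hx).hasFDerivWithinAt) hxb hyb (B := 0)
      (ε := N) fun z hz => by
        simpa using h.norm_two_le z ((convex_ball x₀ δ).segment_subset hxb hyb hz)
    have hφ := h.abs_apply_shearField_le hδ hN hτ hντ hxb
    rw [← hq, ← hW, abs_of_nonneg hℓ] at hφ
    rw [map_smul, smul_eq_mul] at hT
    simp only [_root_.zero_apply, mul_zero, sub_zero] at hT
    have h1 := (abs_le.1 hT).1
    have h2 : N * ‖t • W‖ ^ 2 ≤ N * (t * V) ^ 2 := by gcongr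
    have h3 : |ρ₁ x W| ≤ C₁ / 2 * inner ℝ ν (x - x₀) := by
      refine hφ.trans ?_
      have : (N + 2 * N ^ 2) * ‖x - x₀‖ ^ 2 ≤
        (N + 2 * N ^ 2) * (2 * R * inner ℝ ν (x - x₀)) := by gcongr
      rw [hC₁]
      linarith
    have h4 : -(t * ρ₁ x W) ≤ t * (C₁ / 2 * inner ℝ ν (x - x₀)) := by
      rw [← mul_neg]
      exact mul_le_mul_of_nonneg_left ((neg_le_abs _).trans h3) ht0.le
    have h5 : 2 * ρ x ≤ C₁ * t * inner ℝ ν (x - x₀) + 2 * N * V ^ 2 * t ^ 2 := by linarith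
    have h6 : 0 ≤ C₁ * t * inner ℝ ν (x - x₀) := by positivity
    have h7 : 0 ≤ C₂ * t * inner ℝ ν (x - x₀) := by positivity
    have h8 := h.infDist_compl_le hN hδ' hδδ hNδ (x := x) (by linarith)
    have h9 : (C₁ + C₂) * t * inner ℝ ν (x - x₀) =
      C₁ * t * inner ℝ ν (x - x₀) + C₂ * t * inner ℝ ν (x - x₀) := by ring
    rw [h9]
    exact h8.trans (max_le (by linarith) (by linarith))

end

/-! ### Second differences and the maximum principle -/

section
open Filter Topology Set Metric

section
variable {E : Type*} [NormedAddCommGroup E] [InnerProductSpace ℝ E]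

/-- The symmetric second difference quotients of `g` at `x` in the direction `v` tend to `c`. -/
def HasSecondDifference (g : E → ℝ) (x v : E) (c : ℝ) : Prop :=
  Tendsto (fun t : ℝ => (g (x + t • v) + g (x - t • v) - 2 * g x) / t ^ 2) (𝓝[>] 0) (𝓝 c)

namespace HasSecondDifference
variable {g g' : E → ℝ} {x v : E} {c c' : ℝ}

lemma add (h : HasSecondDifference g x v c) (h' : HasSecondDifference g' x v c') :
    HasSecondDifference (fun y => g y + g' y) x v (c + c') :=
  (Tendsto.add h h').congr fun t => by ring

lemma sub (h : HasSecondDifference g x v c) (h' : HasSecondDifference g' x v c') :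
    HasSecondDifference (fun y => g y - g' y) x v (c - c') :=
  (Tendsto.sub h h').congr fun t => by ring

lemma const_mul (a : ℝ) (h : HasSecondDifference g x v c) :
    HasSecondDifference (fun y => a * g y) x v (a * c) :=
  (Tendsto.const_mul a h).congr fun t => by ring

lemma comp_affine {F : E → E} {w : E} (h : HasSecondDifference g (F x) w c)
    (hF : ∀ t : ℝ, F (x + t • v) = F x + t • w) :
    HasSecondDifference (fun y => g (F y)) x v c := by
  refine Tendsto.congr (fun t => ?_) h
  have := hF (-t)
  rw [neg_smul, neg_smul, ← sub_eq_add_neg, ← sub_eq_add_neg] at this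
  simp only [hF, this]

lemma sq_norm_sub (p x v : E) : HasSecondDifference (fun y => ‖y - p‖ ^ 2) x v (2 * ‖v‖ ^ 2) := by
  refine tendsto_const_nhds.congr' ?_
  filter_upwards [self_mem_nhdsWithin] with t ht
  have ht0 : t ≠ 0 := (ne_of_gt ht : t ≠ 0)
  have e1 : x + t • v - p = (x - p) + t • v := by abel
  have e2 : x - t • v - p = (x - p) - t • v := by abel
  simp only [e1, e2, norm_add_sq_real, norm_sub_sq_real, norm_smul, mul_pow, Real.norm_eq_abs,
    sq_abs]
  field_simp
  ring

lemma inner_sub (w p x v : E) : HasSecondDifference (fun y => inner ℝ w (y - p)) x v 0 := by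
  refine tendsto_const_nhds.congr fun t => ?_
  have e1 : x + t • v - p = (x - p) + t • v := by abel
  have e2 : x - t • v - p = (x - p) - t • v := by abel
  simp only [e1, e2, inner_add_right, inner_sub_right (x := w) (y := x - p)]
  ring

lemma nonpos_of_isMax {D : Set E} (h : HasSecondDifference g x v c) (hD : D ∈ 𝓝 x)
    (hmax : ∀ y ∈ D, g y ≤ g x) : c ≤ 0 := by
  refine le_of_tendsto h ?_
  have h1 : ∀ᶠ t : ℝ in 𝓝[>] 0, x + t • v ∈ D := by
    have : ContinuousAt (fun ε : ℝ => x + ε • v) 0 := by fun_prop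
    exact mem_nhdsWithin_of_mem_nhds
      (this (by simpa using hD : D ∈ 𝓝 (x + (0 : ℝ) • v)))
  have h2 : ∀ᶠ t : ℝ in 𝓝[>] 0, x - t • v ∈ D := by
    have : ContinuousAt (fun ε : ℝ => x - ε • v) 0 := by fun_prop
    exact mem_nhdsWithin_of_mem_nhds
      (this (by simpa using hD : D ∈ 𝓝 (x - (0 : ℝ) • v)))
  filter_upwards [h1, h2] with t ht ht'
  have := hmax _ ht
  have := hmax _ ht'
  exact div_nonpos_of_nonpos_of_nonneg (by linarith) (sq_nonneg t)

end HasSecondDifference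
end

/-! ### Bilinear forms and their matrices -/

variable {n : ℕ}

/-- The matrix of a bilinear form in the standard basis. -/
noncomputable def formMatrix
    (B : EuclideanSpace ℝ (Fin n) →L[ℝ] EuclideanSpace ℝ (Fin n) →L[ℝ] ℝ) :
    Matrix (Fin n) (Fin n) ℝ :=
  Matrix.of fun i j => B (EuclideanSpace.single i 1) (EuclideanSpace.single j 1)

lemma dotProduct_formMatrix_mulVec
    (B : EuclideanSpace ℝ (Fin n) →L[ℝ] EuclideanSpace ℝ (Fin n) →L[ℝ] ℝ) (w : Fin n → ℝ) :
    w ⬝ᵥ (formMatrix B).mulVec w = B (WithLp.toLp 2 w) (WithLp.toLp 2 w) := by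
  have e : WithLp.toLp 2 w = ∑ i, w i • EuclideanSpace.single i (1 : ℝ) := by
    ext j
    simp [Pi.single_apply]
  rw [e]
  simp only [map_sum, map_smul, _root_.sum_apply, _root_.smul_apply, smul_eq_mul,
    dotProduct, Matrix.mulVec, formMatrix, Matrix.of_apply, Finset.mul_sum]
  rw [Finset.sum_comm]
  exact Finset.sum_congr rfl fun i _ => Finset.sum_congr rfl fun j _ => by ring

lemma formMatrix_isHermitian
    {B : EuclideanSpace ℝ (Fin n) →L[ℝ] EuclideanSpace ℝ (Fin n) →L[ℝ] ℝ}
    (hB : ∀ v w, B v w = B w v) : (formMatrix B).IsHermitian := by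
  ext i j
  simp [formMatrix, hB]

lemma formMatrix_posSemidef
    {B : EuclideanSpace ℝ (Fin n) →L[ℝ] EuclideanSpace ℝ (Fin n) →L[ℝ] ℝ}
    (hB : ∀ v w, B v w = B w v) (h0 : ∀ v, 0 ≤ B v v) : (formMatrix B).PosSemidef :=
  .of_dotProduct_mulVec_nonneg (formMatrix_isHermitian hB) fun w => by
    rw [star_trivial, dotProduct_formMatrix_mulVec]; exact h0 _

lemma posSemidef_sub_of_le {P Q : Matrix (Fin n) (Fin n) ℝ} (hP : P.IsHermitian)
    (hQ : Q.IsHermitian) (h : ∀ w, w ⬝ᵥ P.mulVec w ≤ w ⬝ᵥ Q.mulVec w) : (Q - P).PosSemidef :=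
  .of_dotProduct_mulVec_nonneg (hQ.sub hP) fun w => by
    rw [star_trivial, Matrix.sub_mulVec, dotProduct_sub]; linarith [h w]

lemma dotProduct_self_eq_sq_norm (w : Fin n → ℝ) : w ⬝ᵥ w = ‖WithLp.toLp 2 w‖ ^ 2 := by
  rw [EuclideanSpace.real_norm_sq_eq]
  simp [dotProduct, sq]

/-- The matrix of the shear `v ↦ v - t ⟨q, v⟩ ν`. -/
noncomputable def shearMatrix (ν q : EuclideanSpace ℝ (Fin n)) (t : ℝ) :
    Matrix (Fin n) (Fin n) ℝ :=
  1 + Matrix.replicateCol Unit (-t • ν.ofLp) * Matrix.replicateRow Unit q.ofLp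

lemma det_shearMatrix {ν q : EuclideanSpace ℝ (Fin n)} (h : inner ℝ q ν = 0) (t : ℝ) :
    (shearMatrix ν q t).det = 1 := by
  rw [shearMatrix, Matrix.det_one_add_replicateCol_mul_replicateRow, dotProduct_smul]
  have : q.ofLp ⬝ᵥ ν.ofLp = 0 := by
    rw [← h, EuclideanSpace.inner_eq_star_dotProduct, star_trivial, dotProduct_comm]
  rw [this]; simp

lemma shearMatrix_mulVec (ν q : EuclideanSpace ℝ (Fin n)) (t : ℝ) (w : Fin n → ℝ) :
    WithLp.toLp 2 ((shearMatrix ν q t).mulVec w) =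
      WithLp.toLp 2 w - (t * inner ℝ q (WithLp.toLp 2 w)) • ν := by
  have : inner ℝ q (WithLp.toLp 2 w) = q.ofLp ⬝ᵥ w := by
    rw [EuclideanSpace.inner_eq_star_dotProduct, star_trivial, dotProduct_comm]
  rw [this]
  ext i
  simp only [shearMatrix, Matrix.add_mulVec, Matrix.one_mulVec, ← Matrix.vecMulVec_eq,
    Matrix.vecMulVec_mulVec, PiLp.sub_apply, PiLp.smul_apply, Pi.add_apply, Pi.smul_apply,
    smul_eq_mul, MulOpposite.smul_eq_mul_unop, MulOpposite.unop_op]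
  ring

lemma dotProduct_shear_mulVec
    (B : EuclideanSpace ℝ (Fin n) →L[ℝ] EuclideanSpace ℝ (Fin n) →L[ℝ] ℝ)
    (M : Matrix (Fin n) (Fin n) ℝ) (w : Fin n → ℝ) :
    w ⬝ᵥ (star M * formMatrix B * M).mulVec w =
      B (WithLp.toLp 2 (M.mulVec w)) (WithLp.toLp 2 (M.mulVec w)) := by
  rw [← dotProduct_formMatrix_mulVec, ← Matrix.mulVec_mulVec, ← Matrix.mulVec_mulVec,
    Matrix.star_eq_conjTranspose, Matrix.conjTranspose_eq_transpose_of_trivial,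
    Matrix.dotProduct_mulVec, Matrix.vecMul_transpose]

end

/-! ### Comparison with paraboloids -/

section
open Filter Topology Set Metric

lemma HasFDerivWithinAt.tendsto_ray {E F : Type*} [NormedAddCommGroup E] [NormedSpace ℝ E]
    [NormedAddCommGroup F] [NormedSpace ℝ F] {g : E → F} {g' : E →L[ℝ] F} {s : Set E} {x v : E}
    (h : HasFDerivWithinAt g g' s x) (hv : ∀ᶠ t : ℝ in 𝓝[>] 0, x + t • v ∈ s) :
    Tendsto (fun t : ℝ => t⁻¹ • (g (x + t • v) - g x)) (𝓝[>] 0) (𝓝 (g' v)) := by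
  have h0 : Tendsto (fun t : ℝ => t • v) (𝓝[>] 0) (𝓝 0) := by
    have : ContinuousAt (fun t : ℝ => t • v) 0 := by fun_prop
    have h1 := this.tendsto
    rw [zero_smul] at h1
    exact h1.mono_left nhdsWithin_le_nhds
  refine h.lim h0 hv (tendsto_const_nhds.congr' ?_)
  filter_upwards [self_mem_nhdsWithin] with t ht
  rw [smul_smul, inv_mul_cancel₀ (ne_of_gt ht), one_smul]

variable {n : ℕ}

/-- The data of a convex solution `u` of the Dirichlet problem for `det D²u = f` on a convex
domain, with its first and second derivatives `D₁`, `D₂` up to the boundary, together with the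
bounds on `f` that enter the estimates: bounds above and below, a Lipschitz bound and a bound on
symmetric second differences. -/
structure IsRegularSolution (Ω : Set (EuclideanSpace ℝ (Fin n)))
    (f u : EuclideanSpace ℝ (Fin n) → ℝ)
    (D₁ : EuclideanSpace ℝ (Fin n) → EuclideanSpace ℝ (Fin n) →L[ℝ] ℝ)
    (D₂ : EuclideanSpace ℝ (Fin n) →
      EuclideanSpace ℝ (Fin n) →L[ℝ] EuclideanSpace ℝ (Fin n) →L[ℝ] ℝ) (lam K : ℝ) : Prop where
  convexOn : ConvexOn ℝ (closure Ω) u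
  hasD₁ : ∀ x ∈ closure Ω, HasFDerivWithinAt u (D₁ x) (closure Ω) x
  hasD₂ : ∀ x ∈ closure Ω, HasFDerivWithinAt D₁ (D₂ x) (closure Ω) x
  cont : ContinuousOn D₂ (closure Ω)
  symm : ∀ x ∈ closure Ω, ∀ v w, D₂ x v w = D₂ x w v
  det_eq : ∀ x ∈ Ω, (formMatrix (D₂ x)).det = f x
  eq_zero : ∀ x ∈ frontier Ω, u x = 0
  lower : ∀ x ∈ Ω, lam ≤ f x
  upper : ∀ x ∈ Ω, f x ≤ 1 / lam
  lip : ∀ x ∈ Ω, ∀ y ∈ Ω, f x - f y ≤ K * ‖x - y‖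
  second_diff : ∀ x v, x ∈ Ω → x + v ∈ Ω → x - v ∈ Ω →
    2 * f x - (f (x + v) + f (x - v)) ≤ K * ‖v‖ ^ 2

namespace IsRegularSolution
variable {Ω : Set (EuclideanSpace ℝ (Fin n))} {f u : EuclideanSpace ℝ (Fin n) → ℝ}
  {D₁ : EuclideanSpace ℝ (Fin n) → EuclideanSpace ℝ (Fin n) →L[ℝ] ℝ}
  {D₂ : EuclideanSpace ℝ (Fin n) →
      EuclideanSpace ℝ (Fin n) →L[ℝ] EuclideanSpace ℝ (Fin n) →L[ℝ] ℝ} {lam K : ℝ}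

lemma closure_mem_nhds (hΩ : IsOpen Ω) {x : EuclideanSpace ℝ (Fin n)} (hx : x ∈ Ω) :
    closure Ω ∈ 𝓝 x := mem_of_superset (hΩ.mem_nhds hx) subset_closure

lemma hasSecondDifference (h : IsRegularSolution Ω f u D₁ D₂ lam K) (hΩ : IsOpen Ω)
    {x : EuclideanSpace ℝ (Fin n)} (hx : x ∈ Ω) (v : EuclideanSpace ℝ (Fin n)) :
    HasSecondDifference u x v (D₂ x v v) :=
  tendsto_second_difference h.convexOn.1 h.hasD₁ h.hasD₂ h.cont (closure_mem_nhds hΩ hx) v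

lemma continuousOn (h : IsRegularSolution Ω f u D₁ D₂ lam K) : ContinuousOn u (closure Ω) :=
  fun x hx => (h.hasD₁ x hx).continuousWithinAt

lemma continuousOn_quad (h : IsRegularSolution Ω f u D₁ D₂ lam K)
    (v w : EuclideanSpace ℝ (Fin n)) : ContinuousOn (fun x => D₂ x v w) (closure Ω) :=
  (h.cont.clm_apply continuousOn_const).clm_apply continuousOn_const

lemma nonneg (h : IsRegularSolution Ω f u D₁ D₂ lam K) (hΩ : IsOpen Ω)
    {x : EuclideanSpace ℝ (Fin n)} (hx : x ∈ closure Ω) (v : EuclideanSpace ℝ (Fin n)) :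
    0 ≤ D₂ x v v := by
  have hin : ∀ y ∈ Ω, 0 ≤ D₂ y v v := by
    intro y hy
    refine ge_of_tendsto (h.hasSecondDifference hΩ hy v) ?_
    have hD := hΩ.mem_nhds hy
    have h1 : ∀ᶠ t : ℝ in 𝓝[>] 0, y + t • v ∈ Ω := by
      have : ContinuousAt (fun ε : ℝ => y + ε • v) 0 := by fun_prop
      exact mem_nhdsWithin_of_mem_nhds
        (this (by simpa using hD : Ω ∈ 𝓝 (y + (0 : ℝ) • v)))
    have h2 : ∀ᶠ t : ℝ in 𝓝[>] 0, y - t • v ∈ Ω := by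
      have : ContinuousAt (fun ε : ℝ => y - ε • v) 0 := by fun_prop
      exact mem_nhdsWithin_of_mem_nhds
        (this (by simpa using hD : Ω ∈ 𝓝 (y - (0 : ℝ) • v)))
    filter_upwards [h1, h2] with t ht ht'
    have hc := h.convexOn.2 (subset_closure ht) (subset_closure ht')
      (by norm_num : (0 : ℝ) ≤ 1 / 2) (by norm_num : (0 : ℝ) ≤ 1 / 2) (by norm_num)
    have e : (1 / 2 : ℝ) • (y + t • v) + (1 / 2 : ℝ) • (y - t • v) = y := by module
    rw [e, smul_eq_mul, smul_eq_mul] at hc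
    exact div_nonneg (by linarith) (sq_nonneg t)
  exact closure_minimal (s := Ω) (t := closure Ω ∩ (fun x => D₂ x v v) ⁻¹' Ici 0)
    (fun y hy => ⟨subset_closure hy, hin y hy⟩)
    ((h.continuousOn_quad v v).preimage_isClosed_of_isClosed isClosed_closure isClosed_Ici) hx |>.2

lemma posSemidef (h : IsRegularSolution Ω f u D₁ D₂ lam K) (hΩ : IsOpen Ω)
    {x : EuclideanSpace ℝ (Fin n)} (hx : x ∈ closure Ω) : (formMatrix (D₂ x)).PosSemidef :=
  formMatrix_posSemidef (h.symm x hx) (h.nonneg hΩ hx)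

lemma posDef (h : IsRegularSolution Ω f u D₁ D₂ lam K) (hΩ : IsOpen Ω) (hlam : 0 < lam)
    {x : EuclideanSpace ℝ (Fin n)} (hx : x ∈ Ω) : (formMatrix (D₂ x)).PosDef := by
  rw [(h.posSemidef hΩ (subset_closure hx)).posDef_iff_det_ne_zero, h.det_eq x hx]
  exact (hlam.trans_le (h.lower x hx)).ne'

lemma det_le (h : IsRegularSolution Ω f u D₁ D₂ lam K)
    {x : EuclideanSpace ℝ (Fin n)} (hx : x ∈ closure Ω) :
    (formMatrix (D₂ x)).det ≤ 1 / lam := by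
  have hc : ContinuousOn (fun x => (formMatrix (D₂ x)).det) (closure Ω) := by
    have h1 : ContinuousOn (fun x => formMatrix (D₂ x)) (closure Ω) :=
      continuousOn_pi.2 fun i => continuousOn_pi.2 fun j => h.continuousOn_quad _ _
    exact (continuous_id.matrix_det).comp_continuousOn h1
  exact closure_minimal (s := Ω)
    (t := closure Ω ∩ (fun x => (formMatrix (D₂ x)).det) ⁻¹' Iic (1 / lam))
    (fun y hy => ⟨subset_closure hy, by
      simp only [mem_preimage, mem_Iic, h.det_eq y hy]; exact h.upper y hy⟩)
    (hc.preimage_isClosed_of_isClosed isClosed_closure isClosed_Iic) hx |>.2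

lemma lam_le_one (h : IsRegularSolution Ω f u D₁ D₂ lam K) (hlam : 0 < lam) (hne : Ω.Nonempty) :
    lam ≤ 1 := by
  obtain ⟨x, hx⟩ := hne
  have := (h.lower x hx).trans (h.upper x hx)
  rw [le_div_iff₀ hlam] at this
  nlinarith

/-- The form of the equation in which it is used at a maximum point: a positive definite matrix
which stays below `D²u` by a multiple of the identity has a determinant smaller than `f`, by a
definite amount. -/
lemma det_mul_le [NeZero n] (h : IsRegularSolution Ω f u D₁ D₂ lam K) (hΩ : IsOpen Ω)
    (hlam : 0 < lam) {x : EuclideanSpace ℝ (Fin n)} (hx : x ∈ Ω) {P : Matrix (Fin n) (Fin n) ℝ}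
    (hP : P.PosDef) {s : ℝ} (hs : 0 ≤ s)
    (hle : ∀ w : Fin n → ℝ, w ⬝ᵥ P.mulVec w + s * ‖WithLp.toLp 2 w‖ ^ 2 ≤
      D₂ x (WithLp.toLp 2 w) (WithLp.toLp 2 w)) : P.det * (1 + s * lam) ≤ f x := by
  have hH := h.posSemidef hΩ (subset_closure hx)
  have h1s : (s • (1 : Matrix (Fin n) (Fin n) ℝ)).PosSemidef := Matrix.PosSemidef.one.smul hs
  have hle' : (formMatrix (D₂ x) - (P + s • 1)).PosSemidef :=
    posSemidef_sub_of_le (hP.1.add h1s.1) hH.1 fun w => by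
      rw [dotProduct_formMatrix_mulVec, Matrix.add_mulVec, dotProduct_add, Matrix.smul_mulVec,
        Matrix.one_mulVec, dotProduct_smul, dotProduct_self_eq_sq_norm]
      exact hle w
  have h1 : (P + s • 1).det ≤ f x := by
    rw [← h.det_eq x hx]
    exact (hP.posSemidef.add h1s).det_le_det hle'
  have h2 : P.det ≤ (P + s • 1).det :=
    hP.posSemidef.det_le_det (by rw [add_sub_cancel_left]; exact h1s)
  exact (hP.det_mul_le_det_add_smul_one hlam (h.lam_le_one hlam ⟨x, hx⟩)
    (h2.trans (h1.trans (h.upper x hx))) hs).trans h1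

lemma exists_quad_lt [NeZero n] (h : IsRegularSolution Ω f u D₁ D₂ lam K) (hΩ : IsOpen Ω)
    (hlam : 0 < lam) {x : EuclideanSpace ℝ (Fin n)} (hx : x ∈ Ω) {A : ℝ} (hA : 1 / lam < A) :
    ∃ v, D₂ x v v < A * ‖v‖ ^ 2 := by
  by_contra! hcon
  have hlam1 := h.lam_le_one hlam ⟨x, hx⟩
  have h1 : 1 ≤ 1 / lam := by rw [le_div_iff₀ hlam]; linarith
  have hH := h.posSemidef hΩ (subset_closure hx)
  have hA0 : 0 < A := by linarith
  have hAs : (A • (1 : Matrix (Fin n) (Fin n) ℝ)).PosSemidef := Matrix.PosSemidef.one.smul hA0.le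
  have := hAs.det_le_det (B := formMatrix (D₂ x)) (posSemidef_sub_of_le hAs.1 hH.1 fun w => by
      rw [dotProduct_formMatrix_mulVec, Matrix.smul_mulVec,
        Matrix.one_mulVec, dotProduct_smul, dotProduct_self_eq_sq_norm]
      exact hcon _)
  rw [Matrix.det_smul, Matrix.det_one, mul_one, Fintype.card_fin, h.det_eq x hx] at this
  have h2 : A ≤ A ^ n := le_self_pow₀ (by linarith) (NeZero.ne n)
  linarith [h.upper x hx]

lemma exists_lt_quad [NeZero n] (h : IsRegularSolution Ω f u D₁ D₂ lam K) (hΩ : IsOpen Ω)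
    (hlam : 0 < lam) {x : EuclideanSpace ℝ (Fin n)} (hx : x ∈ Ω) {b : ℝ} (hb0 : 0 ≤ b)
    (hb : b < lam) : ∃ v, b * ‖v‖ ^ 2 < D₂ x v v := by
  by_contra! hcon
  have hlam1 := h.lam_le_one hlam ⟨x, hx⟩
  have hH := h.posSemidef hΩ (subset_closure hx)
  have hAs : (b • (1 : Matrix (Fin n) (Fin n) ℝ)).PosSemidef := Matrix.PosSemidef.one.smul hb0
  have := hH.det_le_det (B := b • 1) (posSemidef_sub_of_le hH.1 hAs.1 fun w => by
      rw [dotProduct_formMatrix_mulVec, Matrix.smul_mulVec,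
        Matrix.one_mulVec, dotProduct_smul, dotProduct_self_eq_sq_norm]
      exact hcon _)
  rw [Matrix.det_smul, Matrix.det_one, mul_one, Fintype.card_fin, h.det_eq x hx] at this
  have h2 : b ^ n ≤ b := pow_le_of_le_one hb0 (by linarith) (NeZero.ne n)
  linarith [h.lower x hx]

/-- The paraboloid vanishing on a sphere around the domain is a lower barrier. -/
lemma neg_le_of_subset_ball [NeZero n] (h : IsRegularSolution Ω f u D₁ D₂ lam K) (hΩ : IsOpen Ω)
    (hb : Bornology.IsBounded Ω) (hlam : 0 < lam) {c : EuclideanSpace ℝ (Fin n)} {R : ℝ}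
    (hR : Ω ⊆ ball c R) {z : EuclideanSpace ℝ (Fin n)} (hz : z ∈ closure Ω) :
    -u z ≤ 1 / lam * (R ^ 2 - ‖z - c‖ ^ 2) := by
  have hcb : ∀ x ∈ closure Ω, ‖x - c‖ ≤ R := fun x hx => by
    have := closure_minimal (hR.trans ball_subset_closedBall) isClosed_closedBall hx
    rwa [mem_closedBall, dist_eq_norm] at this
  obtain ⟨y, hy, hmax⟩ := hb.isCompact_closure.exists_isMaxOn ⟨z, hz⟩
    (f := fun x => 1 / lam * ‖x - c‖ ^ 2 - u x)
    (((by fun_prop : Continuous fun x => 1 / lam * ‖x - c‖ ^ 2).continuousOn).sub h.continuousOn)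
  have hyf : y ∉ Ω := by
    intro hyΩ
    obtain ⟨v, hv⟩ := h.exists_quad_lt hΩ hlam hyΩ (A := 2 * (1 / lam))
      (by have : 0 < 1 / lam := by positivity
          linarith)
    have := (((HasSecondDifference.sq_norm_sub c y v).const_mul (1 / lam)).sub
      (h.hasSecondDifference hΩ hyΩ v)).nonpos_of_isMax (closure_mem_nhds hΩ hyΩ) hmax
    linarith
  have hu : u y = 0 := h.eq_zero y (by rw [hΩ.frontier_eq]; exact ⟨hy, hyf⟩)
  have h1 : 1 / lam * ‖z - c‖ ^ 2 - u z ≤ 1 / lam * ‖y - c‖ ^ 2 - u y := hmax hz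
  have h2 : 1 / lam * ‖y - c‖ ^ 2 ≤ 1 / lam * R ^ 2 := by
    gcongr
    exact hcb y hy
  rw [mul_sub]
  linarith

lemma neg_le_mul_norm_sub [NeZero n] (h : IsRegularSolution Ω f u D₁ D₂ lam K) (hΩ : IsOpen Ω)
    (hb : Bornology.IsBounded Ω) (hlam : 0 < lam) {y ν : EuclideanSpace ℝ (Fin n)} {R : ℝ}
    (hν : ‖ν‖ = 1) (hR0 : 0 < R) (hR : Ω ⊆ ball (y + R • ν) R) {z : EuclideanSpace ℝ (Fin n)}
    (hz : z ∈ closure Ω) : -u z ≤ 2 * R / lam * ‖z - y‖ := by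
  have h1 := h.neg_le_of_subset_ball hΩ hb hlam hR hz
  have h2 := closure_minimal (hR.trans ball_subset_closedBall) isClosed_closedBall hz
  rw [mem_closedBall, dist_eq_norm] at h2
  have h3 : R ≤ ‖z - y‖ + ‖z - (y + R • ν)‖ := by
    have e : R • ν = (z - y) - (z - (y + R • ν)) := by abel
    have : ‖R • ν‖ = R := by rw [norm_smul, hν, mul_one, Real.norm_of_nonneg hR0.le]
    calc R = ‖(z - y) - (z - (y + R • ν))‖ := by rw [← e, this]
      _ ≤ _ := norm_sub_le _ _
  have h4 : R ^ 2 - ‖z - (y + R • ν)‖ ^ 2 ≤ 2 * R * ‖z - y‖ := by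
    nlinarith [norm_nonneg (z - (y + R • ν)), norm_nonneg (z - y)]
  calc -u z ≤ 1 / lam * (2 * R * ‖z - y‖) := h1.trans (by gcongr)
    _ = _ := by ring

lemma nonpos [NeZero n] (h : IsRegularSolution Ω f u D₁ D₂ lam K) (hΩ : IsOpen Ω)
    (hb : Bornology.IsBounded Ω) (hlam : 0 < lam) {z : EuclideanSpace ℝ (Fin n)}
    (hz : z ∈ closure Ω) : u z ≤ 0 := by
  obtain ⟨y, hy, hmax⟩ := hb.isCompact_closure.exists_isMaxOn ⟨z, hz⟩ h.continuousOn
  have hyf : y ∉ Ω := by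
    intro hyΩ
    obtain ⟨v, hv⟩ := h.exists_lt_quad hΩ hlam hyΩ le_rfl hlam
    have := (h.hasSecondDifference hΩ hyΩ v).nonpos_of_isMax (closure_mem_nhds hΩ hyΩ) hmax
    linarith
  exact (hmax hz).trans (h.eq_zero y (by rw [hΩ.frontier_eq]; exact ⟨hy, hyf⟩)).le

/-- The paraboloid vanishing on a sphere inside the domain is an upper barrier. -/
lemma le_of_closedBall_subset [NeZero n] (h : IsRegularSolution Ω f u D₁ D₂ lam K)
    (hΩ : IsOpen Ω) (hb : Bornology.IsBounded Ω) (hlam : 0 < lam)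
    {p : EuclideanSpace ℝ (Fin n)} {r : ℝ} (hr : 0 < r) (hp : closedBall p r ⊆ Ω) :
    u p ≤ -(lam / 4 * r ^ 2) := by
  obtain ⟨y, hy, hmax⟩ := (isCompact_closedBall p r).exists_isMaxOn ⟨p, mem_closedBall_self hr.le⟩
    (f := fun x => u x - lam / 4 * ‖x - p‖ ^ 2)
    ((h.continuousOn.mono (hp.trans subset_closure)).sub
      (by fun_prop : Continuous fun x => lam / 4 * ‖x - p‖ ^ 2).continuousOn)
  have hyb : ¬ ‖y - p‖ < r := by
    intro hlt
    have hyΩ := hp hy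
    obtain ⟨v, hv⟩ := h.exists_lt_quad hΩ hlam hyΩ (b := lam / 2) (by positivity) (by linarith)
    have hD : closedBall p r ∈ 𝓝 y :=
      mem_of_superset (isOpen_ball.mem_nhds (by rwa [mem_ball, dist_eq_norm]))
        ball_subset_closedBall
    have := ((h.hasSecondDifference hΩ hyΩ v).sub
      ((HasSecondDifference.sq_norm_sub p y v).const_mul (lam / 4))).nonpos_of_isMax hD hmax
    linarith
  have h1 : u p - lam / 4 * ‖p - p‖ ^ 2 ≤ u y - lam / 4 * ‖y - p‖ ^ 2 :=
    hmax (mem_closedBall_self hr.le)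
  have h2 : u y ≤ 0 := h.nonpos hΩ hb hlam (subset_closure (hp hy))
  have h3 : lam / 4 * r ^ 2 ≤ lam / 4 * ‖y - p‖ ^ 2 := by
    gcongr
    exact not_lt.1 hyb
  simp only [sub_self, norm_zero] at h1
  linarith

/-- A convex function lies above its tangent planes, also at boundary points. -/
lemma apply_sub_le (h : IsRegularSolution Ω f u D₁ D₂ lam K) {x y : EuclideanSpace ℝ (Fin n)}
    (hx : x ∈ closure Ω) (hy : y ∈ closure Ω) : D₁ x (y - x) ≤ u y - u x := by
  have hseg : ∀ t : ℝ, 0 < t → t ≤ 1 → x + t • (y - x) ∈ closure Ω := fun t h0 h1 =>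
    h.convexOn.1.add_smul_sub_mem hx hy ⟨h0.le, h1⟩
  have h01 : ∀ᶠ t : ℝ in 𝓝[>] 0, 0 < t ∧ t ≤ 1 :=
    (eventually_mem_nhdsWithin).and (mem_nhdsWithin_of_mem_nhds (Iic_mem_nhds one_pos))
  have hlim := (h.hasD₁ x hx).tendsto_ray (h01.mono fun t ht => hseg t ht.1 ht.2)
  refine le_of_tendsto hlim (h01.mono fun t ht => ?_)
  have := h.convexOn.2 hx hy (sub_nonneg.2 ht.2) ht.1.le (sub_add_cancel 1 t)
  have e : (1 - t) • x + t • y = x + t • (y - x) := by module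
  rw [e, smul_eq_mul, smul_eq_mul] at this
  rw [smul_eq_mul, inv_mul_le_iff₀ ht.1]
  linarith

end IsRegularSolution

end

/-! ### Tangential derivatives near the boundary -/

section
open Filter Topology Set Metric
variable {n : ℕ}

lemma shear_add_smul (x₀ ν τ q x v : EuclideanSpace ℝ (Fin n)) (t s : ℝ) :
    x + s • v + t • shearField x₀ ν τ q (x + s • v) =
      x + t • shearField x₀ ν τ q x + s • (v - (t * inner ℝ q v) • ν) := by
  have e : x + s • v - x₀ = (x - x₀) + s • v := by abel
  rw [shearField, shearField, e, inner_add_right, inner_smul_right]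
  module

lemma continuous_shearField (x₀ ν τ q : EuclideanSpace ℝ (Fin n)) :
    Continuous (shearField x₀ ν τ q) := by
  unfold shearField
  fun_prop

namespace IsRegularSolution
variable {Ω : Set (EuclideanSpace ℝ (Fin n))} {f u : EuclideanSpace ℝ (Fin n) → ℝ}
  {D₁ : EuclideanSpace ℝ (Fin n) → EuclideanSpace ℝ (Fin n) →L[ℝ] ℝ}
  {D₂ : EuclideanSpace ℝ (Fin n) →
      EuclideanSpace ℝ (Fin n) →L[ℝ] EuclideanSpace ℝ (Fin n) →L[ℝ] ℝ} {lam K : ℝ}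

lemma neg_le_mul_infDist [NeZero n] (h : IsRegularSolution Ω f u D₁ D₂ lam K) (hΩ : IsOpen Ω)
    (hb : Bornology.IsBounded Ω) (hlam : 0 < lam) {R : ℝ} (hR0 : 0 < R)
    (hR : ∀ y ∈ frontier Ω, ∃ ν : EuclideanSpace ℝ (Fin n), ‖ν‖ = 1 ∧ Ω ⊆ ball (y + R • ν) R)
    {z : EuclideanSpace ℝ (Fin n)} (hz : z ∈ Ω) : -u z ≤ 2 * R / lam * infDist z Ωᶜ := by
  have hne : Ω ≠ univ := by
    rintro rfl
    exact NoncompactSpace.noncompact_univ (by simpa using hb.isCompact_closure)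
  obtain ⟨y, hy, hyd⟩ := exists_mem_frontier_infDist_compl_eq_dist hz hne
  obtain ⟨ν, hν, hsub⟩ := hR y hy
  rw [hyd, dist_eq_norm]
  exact h.neg_le_mul_norm_sub hΩ hb hlam hν hR0 hsub (subset_closure hz)

/-- Where the composition of `u` with the shear, corrected by a paraboloid of the form
`t a ‖x - x₀‖² - b ⟨ν, x - x₀⟩`, has an interior local maximum relative to `u`, the opening of the
paraboloid is bounded. The shear is unimodular, so that the composition solves an equation of the
same form. -/
lemma opening_le_of_isMax [NeZero n] (h : IsRegularSolution Ω f u D₁ D₂ lam K) (hΩ : IsOpen Ω)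
    (hlam : 0 < lam) {x₀ ν τ q y : EuclideanSpace ℝ (Fin n)} {t a b V : ℝ} (ht : 0 < t)
    (hqν : inner ℝ q ν = 0) (hy : y ∈ Ω) (hEy : y + t • shearField x₀ ν τ q y ∈ Ω) (ha : 0 ≤ a)
    (hV : ‖shearField x₀ ν τ q y‖ ≤ V) {D : Set (EuclideanSpace ℝ (Fin n))} (hD : D ∈ 𝓝 y)
    (hmax : ∀ x ∈ D, u (x + t • shearField x₀ ν τ q x) - u x +
        (t * a * ‖x - x₀‖ ^ 2 - b * inner ℝ ν (x - x₀)) ≤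
      u (y + t • shearField x₀ ν τ q y) - u y +
        (t * a * ‖y - x₀‖ ^ 2 - b * inner ℝ ν (y - x₀))) :
    2 * a * lam ^ 2 ≤ |K| * V := by
  set y' := y + t • shearField x₀ ν τ q y with hy'
  have hquad : ∀ v : EuclideanSpace ℝ (Fin n), D₂ y' (v - (t * inner ℝ q v) • ν)
      (v - (t * inner ℝ q v) • ν) + t * (2 * a) * ‖v‖ ^ 2 ≤ D₂ y v v := by
    intro v
    have h1 := ((h.hasSecondDifference hΩ hEy (v - (t * inner ℝ q v) • ν)).comp_affine (x := y)
      (v := v) (F := fun x => x + t • shearField x₀ ν τ q x)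
      fun s => shear_add_smul x₀ ν τ q y v t s).sub (h.hasSecondDifference hΩ hy v)
    have h2 := ((HasSecondDifference.sq_norm_sub x₀ y v).const_mul (t * a)).sub
      ((HasSecondDifference.inner_sub ν x₀ y v).const_mul b)
    have := (h1.add h2).nonpos_of_isMax hD hmax
    linarith
  set P := star (shearMatrix ν q t) * formMatrix (D₂ y') * shearMatrix ν q t with hP
  have hdet := det_shearMatrix hqν t
  have hunit : IsUnit (shearMatrix ν q t) := by
    rw [Matrix.isUnit_iff_isUnit_det, hdet]; exact isUnit_one
  have hPpos : P.PosDef := by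
    rw [hP, Matrix.IsUnit.posDef_star_left_conjugate_iff hunit]
    exact h.posDef hΩ hlam hEy
  have hPdet : P.det = f y' := by
    rw [hP, Matrix.det_mul, Matrix.det_mul, Matrix.star_eq_conjTranspose,
      Matrix.det_conjTranspose, hdet, h.det_eq y' hEy]
    simp
  have hmain := h.det_mul_le hΩ hlam hy hPpos (s := t * (2 * a)) (by positivity) fun w => by
    rw [hP, dotProduct_shear_mulVec, shearMatrix_mulVec]
    exact hquad _
  rw [hPdet] at hmain
  have hlip := h.lip y hy y' hEy
  have hn : ‖y - y'‖ ≤ t * V := by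
    rw [hy', sub_add_cancel_left, norm_neg, norm_smul, Real.norm_of_nonneg ht.le]
    exact mul_le_mul_of_nonneg_left hV ht.le
  have h3 : K * ‖y - y'‖ ≤ |K| * (t * V) :=
    (mul_le_mul_of_nonneg_right (le_abs_self K) (norm_nonneg _)).trans
      (mul_le_mul_of_nonneg_left hn (abs_nonneg K))
  have h4 : lam * (t * (2 * a) * lam) ≤ f y' * (t * (2 * a) * lam) :=
    mul_le_mul_of_nonneg_right (h.lower y' hEy) (by positivity)
  have h5 : t * (2 * a * lam ^ 2) ≤ t * (|K| * V) := by linarith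
  exact le_of_mul_le_mul_left h5 ht

/-- The derivative of the solution along the field tangent to the boundary at `x₀` is dominated by
the height above the tangent plane at `x₀`, with a uniform constant. -/
lemma exists_apply_shearField_le [NeZero n] (hΩ : IsOpen Ω) (hb : Bornology.IsBounded Ω)
    (hlam : 0 < lam) (K : ℝ) {δ N R d : ℝ} (hδ : 0 < δ) (hN : 0 < N) (hR : 0 < R) (hd : 0 ≤ d)
    (hdiam : ∀ x ∈ closure Ω, ∀ y ∈ closure Ω, ‖x - y‖ ≤ d)
    (hball : ∀ y ∈ frontier Ω, ∃ ν : EuclideanSpace ℝ (Fin n),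
      ‖ν‖ = 1 ∧ Ω ⊆ ball (y + R • ν) R) :
    ∃ A : ℝ, 0 < A ∧ ∀ f u D₁ D₂, IsRegularSolution Ω f u D₁ D₂ lam K →
      ∀ x₀ ∈ frontier Ω, ∀ ν ρ ρ₁ ρ₂, IsBoundaryChart Ω x₀ ν ρ ρ₁ ρ₂ δ N →
      Ω ⊆ ball (x₀ + R • ν) R → ∀ τ, ‖τ‖ = 1 → inner ℝ ν τ = 0 → ∀ x ∈ Ω,
        D₁ x (shearField x₀ ν τ (bendVector (ρ₂ x₀) ν τ) x) ≤ A * inner ℝ ν (x - x₀) := by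
  obtain ⟨C, C', t₀, hC, ht₀, hdist⟩ :=
    exists_infDist_compl_le_of_shear_mem_frontier hΩ hδ hN hR hd
  set V : ℝ := 1 + 2 * N * d with hV
  set L : ℝ := 2 * R / lam with hL
  set a : ℝ := |K| * V / lam ^ 2 + 1 with ha
  have hVpos : 0 < V := by positivity
  have hLpos : 0 < L := by positivity
  have hapos : 0 < a := by positivity
  refine ⟨2 * a * R + L * C, by positivity, ?_⟩
  intro f u D₁ D₂ h x₀ hx₀ ν ρ ρ₁ ρ₂ hc hΩR τ hτ hντ x hx
  set A : ℝ := 2 * a * R + L * C with hA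
  set q := bendVector (ρ₂ x₀) ν τ with hq
  have hνν : inner ℝ ν ν = (1 : ℝ) := by rw [real_inner_self_eq_norm_sq, hc.norm_normal]; norm_num
  have hqν : inner ℝ q ν = 0 := by rw [hq, inner_bendVector, hνν]; ring
  have hqn : ‖q‖ ≤ 2 * N := norm_bendVector_le
    (hc.norm_two_le x₀ (mem_ball_self hδ)) hc.norm_normal hτ
  have hx₀c : x₀ ∈ closure Ω := frontier_subset_closure hx₀
  have hVx : ∀ z ∈ closure Ω, ‖shearField x₀ ν τ q z‖ ≤ V := fun z hz =>
    norm_shearField_le hN.le hc.norm_normal hτ hqn (hdiam z hz x₀ hx₀c)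
  have hsq : ∀ z ∈ closure Ω, ‖z - x₀‖ ^ 2 ≤ 2 * R * inner ℝ ν (z - x₀) := fun z hz =>
    sq_norm_sub_le_of_subset_ball hc.norm_normal hR hΩR hz
  have hℓ : ∀ z ∈ closure Ω, 0 ≤ inner ℝ ν (z - x₀) := fun z hz => by
    by_contra! hneg
    nlinarith [sq_nonneg ‖z - x₀‖, hsq z hz]
  have hfront : ∀ z ∈ closure Ω, z ∉ Ω → z ∈ frontier Ω := fun z hz hzΩ => by
    rw [hΩ.frontier_eq]; exact ⟨hz, hzΩ⟩
  have key : ∀ t, 0 < t → t < t₀ → ∀ z ∈ closure Ω,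
      z + t • shearField x₀ ν τ q z ∈ closure Ω →
      u (z + t • shearField x₀ ν τ q z) - u z ≤ t * (A * inner ℝ ν (z - x₀) + L * |C'| * t) := by
    intro t ht0 ht z hz hEz
    have hE : Continuous fun x => x + t • shearField x₀ ν τ q x :=
      continuous_id.add ((continuous_shearField x₀ ν τ q).const_smul t)
    set D := closure Ω ∩ (fun x => x + t • shearField x₀ ν τ q x) ⁻¹' closure Ω with hD
    have hDc : IsCompact D := hb.isCompact_closure.inter_right (isClosed_closure.preimage hE)
    obtain ⟨y, hyD, hmax⟩ := hDc.exists_isMaxOn ⟨z, hz, hEz⟩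
      (f := fun x => u (x + t • shearField x₀ ν τ q x) - u x +
        (t * a * ‖x - x₀‖ ^ 2 - t * A * inner ℝ ν (x - x₀)))
      (((h.continuousOn.comp hE.continuousOn fun x hx => hx.2).sub
        (h.continuousOn.mono inter_subset_left)).add
        (by fun_prop : Continuous fun x => t * a * ‖x - x₀‖ ^ 2 -
          t * A * inner ℝ ν (x - x₀)).continuousOn)
    have hy := hyD.1
    have hsqy : t * a * ‖y - x₀‖ ^ 2 ≤ t * a * (2 * R * inner ℝ ν (y - x₀)) :=
      mul_le_mul_of_nonneg_left (hsq y hy) (by positivity)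
    have hℓy : 0 ≤ t * (L * C) * inner ℝ ν (y - x₀) :=
      mul_nonneg (by positivity) (hℓ y hy)
    have hC' : 0 ≤ L * |C'| * t ^ 2 := by positivity
    have hAy : t * A * inner ℝ ν (y - x₀) =
        t * a * (2 * R * inner ℝ ν (y - x₀)) + t * (L * C) * inner ℝ ν (y - x₀) := by
      rw [hA]; ring
    have hΦ : u (y + t • shearField x₀ ν τ q y) - u y +
        (t * a * ‖y - x₀‖ ^ 2 - t * A * inner ℝ ν (y - x₀)) ≤ L * |C'| * t ^ 2 := by
      by_cases hyΩ : y ∈ Ω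
      · by_cases hEy : y + t • shearField x₀ ν τ q y ∈ Ω
        · exfalso
          have hDn : D ∈ 𝓝 y := mem_of_superset
            ((hΩ.inter (hΩ.preimage hE)).mem_nhds ⟨hyΩ, hEy⟩)
            (inter_subset_inter subset_closure (preimage_mono subset_closure))
          have := h.opening_le_of_isMax hΩ hlam ht0 hqν hyΩ hEy hapos.le (hVx y hy) hDn hmax
          have e : 2 * a * lam ^ 2 = 2 * (|K| * V) + 2 * lam ^ 2 := by rw [ha]; field_simp
          have : 0 ≤ |K| * V := by positivity
          have : 0 < lam ^ 2 := by positivity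
          linarith
        · have hf := hfront _ hyD.2 hEy
          have h1 := h.neg_le_mul_infDist hΩ hb hlam hR hball hyΩ
          have h2 := hdist x₀ ν ρ ρ₁ ρ₂ hc hΩR τ hτ hντ t ht0 ht y hy (hdiam y hy x₀ hx₀c) hf
          have h3 : L * infDist y Ωᶜ ≤ L * (C * t * inner ℝ ν (y - x₀) + C' * t ^ 2) :=
            mul_le_mul_of_nonneg_left h2 hLpos.le
          have h4 : L * (C' * t ^ 2) ≤ L * (|C'| * t ^ 2) := by
            gcongr
            exact le_abs_self C'
          rw [h.eq_zero _ hf]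
          linarith
      · have h1 := h.eq_zero y (hfront y hy hyΩ)
        have h2 := h.nonpos hΩ hb hlam hyD.2
        linarith
    have h1 : u (z + t • shearField x₀ ν τ q z) - u z +
        (t * a * ‖z - x₀‖ ^ 2 - t * A * inner ℝ ν (z - x₀)) ≤ _ := hmax ⟨hz, hEz⟩
    have h2 : 0 ≤ t * a * ‖z - x₀‖ ^ 2 := by positivity
    linarith
  have hxc : x ∈ closure Ω := subset_closure hx
  have hin : ∀ᶠ t : ℝ in 𝓝[>] 0, x + t • shearField x₀ ν τ q x ∈ closure Ω := by
    have : ContinuousAt (fun ε : ℝ => x + ε • shearField x₀ ν τ q x) 0 := by fun_prop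
    exact mem_nhdsWithin_of_mem_nhds (this (by
      simpa using closure_mem_nhds hΩ hx :
        closure Ω ∈ 𝓝 (x + (0 : ℝ) • shearField x₀ ν τ q x)))
  have hlim := (h.hasD₁ x hxc).tendsto_ray hin
  have hlim' : Tendsto (fun t : ℝ => A * inner ℝ ν (x - x₀) + L * |C'| * t) (𝓝[>] 0)
      (𝓝 (A * inner ℝ ν (x - x₀))) := by
    have : Continuous fun t : ℝ => A * inner ℝ ν (x - x₀) + L * |C'| * t := by fun_prop
    simpa using (this.tendsto 0).mono_left (nhdsWithin_le_nhds (s := Ioi 0))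
  refine le_of_tendsto_of_tendsto hlim hlim' ?_
  filter_upwards [hin, self_mem_nhdsWithin, mem_nhdsWithin_of_mem_nhds (Iio_mem_nhds ht₀)]
    with t h1 h2 h3
  have h2' : (0 : ℝ) < t := h2
  rw [smul_eq_mul, inv_mul_le_iff₀ h2']
  exact key t h2' h3 x hxc h1

end IsRegularSolution

end

/-! ### Second derivatives at the boundary -/

section
open Filter Topology Set Metric
variable {n : ℕ}

/-- A bilinear form which is nonnegative, bounded on the hyperplane `ν^⊥`, bounded below there by a
positive constant, and whose mixed terms are bounded, is bounded if its determinant is. -/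
lemma apply_self_le_of_det_le [NeZero n]
    {B : EuclideanSpace ℝ (Fin n) →L[ℝ] EuclideanSpace ℝ (Fin n) →L[ℝ] ℝ}
    (hsymm : ∀ v w, B v w = B w v) (hnonneg : ∀ v, 0 ≤ B v v) {ν : EuclideanSpace ℝ (Fin n)}
    (hν : ‖ν‖ = 1) {c T A Λ : ℝ} (hc : 0 < c) (hT : 0 ≤ T) (hΛ : 0 ≤ Λ)
    (hlow : ∀ τ, ‖τ‖ = 1 → inner ℝ ν τ = 0 → c ≤ B τ τ)
    (hup : ∀ τ, ‖τ‖ = 1 → inner ℝ ν τ = 0 → B τ τ ≤ T)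
    (hmix : ∀ τ, ‖τ‖ = 1 → inner ℝ ν τ = 0 → |B ν τ| ≤ A) (hdet : (formMatrix B).det ≤ Λ)
    (e : EuclideanSpace ℝ (Fin n)) :
    B e e ≤ 2 * (T + (2 * A ^ 2 / c + Λ / (c / 2) ^ n * (c / 2))) * ‖e‖ ^ 2 := by
  have hνν : inner ℝ ν ν = (1 : ℝ) := by rw [real_inner_self_eq_norm_sq, hν]; norm_num
  -- the three bounds for tangential vectors of arbitrary length
  have hom : ∀ τ, inner ℝ ν τ = 0 →
      c * ‖τ‖ ^ 2 ≤ B τ τ ∧ B τ τ ≤ T * ‖τ‖ ^ 2 ∧ |B ν τ| ≤ A * ‖τ‖ := by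
    intro τ hτ
    by_cases h0 : τ = 0
    · simp [h0]
    have hpos : 0 < ‖τ‖ := norm_pos_iff.2 h0
    set σ := ‖τ‖⁻¹ • τ with hσ
    have hτσ : τ = ‖τ‖ • σ := by rw [hσ, smul_smul, mul_inv_cancel₀ hpos.ne', one_smul]
    have hσn : ‖σ‖ = 1 := by rw [hσ, norm_smul, norm_inv, norm_norm, inv_mul_cancel₀ hpos.ne']
    have hσν : inner ℝ ν σ = 0 := by rw [hσ, inner_smul_right, hτ, mul_zero]
    have e1 : B τ τ = ‖τ‖ ^ 2 * B σ σ := by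
      conv_lhs => rw [hτσ]
      simp only [map_smul, _root_.smul_apply, smul_eq_mul]
      ring
    have e2 : B ν τ = ‖τ‖ * B ν σ := by
      conv_lhs => rw [hτσ]
      simp only [map_smul, smul_eq_mul]
    refine ⟨?_, ?_, ?_⟩
    · rw [e1, mul_comm]; gcongr; exact hlow σ hσn hσν
    · rw [e1, mul_comm]; gcongr; exact hup σ hσn hσν
    · rw [e2, abs_mul, abs_of_pos hpos, mul_comm]; gcongr; exact hmix σ hσn hσν
  have hdecomp : ∀ v : EuclideanSpace ℝ (Fin n), ∃ τ, inner ℝ ν τ = 0 ∧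
      v = τ + inner ℝ ν v • ν ∧ ‖v‖ ^ 2 = ‖τ‖ ^ 2 + inner ℝ ν v ^ 2 := by
    intro v
    refine ⟨v - inner ℝ ν v • ν, ?_, by abel, ?_⟩
    · rw [inner_sub_right, inner_smul_right, hνν]; ring
    · rw [norm_sub_sq_real, inner_smul_right, norm_smul, hν, real_inner_comm, mul_one,
        Real.norm_eq_abs, sq_abs]
      ring
  set m : ℝ := B ν ν - 2 * A ^ 2 / c with hm
  -- completing the square bounds the form below by one with an explicit determinant
  have hbelow : ∀ v, c / 2 * ‖v‖ ^ 2 + (m - c / 2) * inner ℝ ν v ^ 2 ≤ B v v := by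
    intro v
    obtain ⟨τ, hτ, hv, hvn⟩ := hdecomp v
    set s := inner ℝ ν v with hs
    obtain ⟨h1, -, h3⟩ := hom τ hτ
    have e1 : B v v = B τ τ + 2 * s * B ν τ + s ^ 2 * B ν ν := by
      rw [hv]
      simp only [map_add, map_smul, _root_.add_apply, _root_.smul_apply, smul_eq_mul,
        hsymm τ ν]
      ring
    have h4 : -(2 * |s| * (A * ‖τ‖)) ≤ 2 * s * B ν τ := by
      have : |2 * s * B ν τ| ≤ 2 * |s| * (A * ‖τ‖) := by
        rw [abs_mul, abs_mul, abs_two]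
        gcongr
      exact (abs_le.1 this).1
    have h5 : 2 * |s| * (A * ‖τ‖) ≤ c / 2 * ‖τ‖ ^ 2 + 2 * A ^ 2 / c * s ^ 2 := by
      have h6 : 0 ≤ (c * ‖τ‖ - 2 * A * |s|) ^ 2 / (2 * c) := by positivity
      have h7 : (c * ‖τ‖ - 2 * A * |s|) ^ 2 / (2 * c) =
          c / 2 * ‖τ‖ ^ 2 + 2 * A ^ 2 / c * s ^ 2 - 2 * |s| * (A * ‖τ‖) := by
        rw [← sq_abs s]
        field_simp
        ring
      linarith
    rw [e1, hvn, hm]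
    linarith
  have hmle : m ≤ Λ / (c / 2) ^ n * (c / 2) := by
    rcases le_or_gt m 0 with hm0 | hm0
    · exact hm0.trans (by positivity)
    set G : Matrix (Fin n) (Fin n) ℝ :=
      (c / 2) • (1 : Matrix (Fin n) (Fin n) ℝ) + (m - c / 2) • Matrix.vecMulVec ν.ofLp ν.ofLp
      with hG
    have hνdot : ν.ofLp ⬝ᵥ ν.ofLp = 1 := by rw [dotProduct_self_eq_sq_norm]; simp [hν]
    have hGw : ∀ w : Fin n → ℝ, w ⬝ᵥ G.mulVec w = c / 2 * ‖WithLp.toLp 2 w‖ ^ 2 +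
        (m - c / 2) * inner ℝ ν (WithLp.toLp 2 w) ^ 2 := by
      intro w
      have : inner ℝ ν (WithLp.toLp 2 w) = ν.ofLp ⬝ᵥ w := by
        rw [EuclideanSpace.inner_eq_star_dotProduct, star_trivial, dotProduct_comm]
      rw [this, hG, Matrix.add_mulVec, Matrix.smul_mulVec, Matrix.smul_mulVec, Matrix.one_mulVec,
        Matrix.vecMulVec_mulVec, dotProduct_add, dotProduct_smul, dotProduct_smul,
        dotProduct_self_eq_sq_norm, op_smul_eq_smul, dotProduct_smul, dotProduct_comm w]
      simp only [smul_eq_mul]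
      ring
    have hGh : G.IsHermitian := by
      ext i j
      simp [hG, Matrix.vecMulVec_apply, Matrix.one_apply, eq_comm, mul_comm]
    have hGpos : G.PosSemidef := .of_dotProduct_mulVec_nonneg hGh fun w => by
      rw [star_trivial, hGw]
      obtain ⟨τ, -, -, hvn⟩ := hdecomp (WithLp.toLp 2 w)
      rw [hvn]
      have h1 : 0 ≤ c / 2 * ‖τ‖ ^ 2 := by positivity
      have h2 : 0 ≤ m * inner ℝ ν (WithLp.toLp 2 w) ^ 2 := by positivity
      linarith
    have h1 := hGpos.det_le_det (B := formMatrix B)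
      (posSemidef_sub_of_le hGh (formMatrix_isHermitian hsymm) fun w => by
        rw [hGw, dotProduct_formMatrix_mulVec]; exact hbelow _)
    rw [hG, Matrix.det_smul_one_add_smul_vecMulVec _ _ _ (by positivity) hνdot,
      Fintype.card_fin] at h1
    have h2 : (c / 2) ^ n * (1 + (m - c / 2) / (c / 2)) = (c / 2) ^ n * m / (c / 2) := by
      field_simp
      ring
    rw [h2] at h1
    have h3 := h1.trans hdet
    rw [div_mul_eq_mul_div, le_div_iff₀ (by positivity)]
    rw [div_le_iff₀ (by positivity)] at h3
    linarith
  obtain ⟨τ, hτ, hv, hvn⟩ := hdecomp e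
  set s := inner ℝ ν e with hs
  have h1 := hnonneg (τ - s • ν)
  have e1 : B e e + B (τ - s • ν) (τ - s • ν) = 2 * B τ τ + 2 * (s ^ 2 * B ν ν) := by
    rw [hv]
    simp only [map_add, map_sub, map_smul, _root_.add_apply, _root_.sub_apply, _root_.smul_apply,
      smul_eq_mul]
    ring
  have h2 := (hom τ hτ).2.1
  have hν0 := hnonneg ν
  set Q : ℝ := 2 * A ^ 2 / c + Λ / (c / 2) ^ n * (c / 2) with hQ
  have hQ0 : 0 ≤ Q := by positivity
  have h3 : s ^ 2 * B ν ν ≤ s ^ 2 * Q := by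
    gcongr
    linarith
  rw [hvn]
  nlinarith [mul_nonneg hT (sq_nonneg s), mul_nonneg hQ0 (sq_nonneg ‖τ‖)]

namespace IsRegularSolution
variable {Ω : Set (EuclideanSpace ℝ (Fin n))} {f u : EuclideanSpace ℝ (Fin n) → ℝ}
  {D₁ : EuclideanSpace ℝ (Fin n) → EuclideanSpace ℝ (Fin n) →L[ℝ] ℝ}
  {D₂ : EuclideanSpace ℝ (Fin n) →
      EuclideanSpace ℝ (Fin n) →L[ℝ] EuclideanSpace ℝ (Fin n) →L[ℝ] ℝ} {lam K : ℝ}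

/-- The bound on the tangential derivative along a ray which enters the domain is a bound on the
mixed second derivatives at the boundary point. -/
lemma abs_two_apply_sub_le (h : IsRegularSolution Ω f u D₁ D₂ lam K)
    {x₀ ν τ q y : EuclideanSpace ℝ (Fin n)} (hx₀ : x₀ ∈ closure Ω) {A : ℝ}
    (hy : ∀ᶠ ε : ℝ in 𝓝[>] 0, x₀ + ε • y ∈ Ω)
    (hA : ∀ x ∈ Ω, |D₁ x (shearField x₀ ν τ q x)| ≤ A * inner ℝ ν (x - x₀)) :
    D₁ x₀ τ = 0 ∧ |D₂ x₀ y τ - inner ℝ q y * D₁ x₀ ν| ≤ A * inner ℝ ν y := by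
  have hG := (h.hasD₂ x₀ hx₀).tendsto_ray (hy.mono fun t ht => subset_closure ht)
  set G := fun t : ℝ => t⁻¹ • (D₁ (x₀ + t • y) - D₁ x₀) with hGdef
  have hGe : ∀ t : ℝ, 0 < t → ∀ w, D₁ (x₀ + t • y) w = D₁ x₀ w + t * G t w := by
    intro t ht w
    simp only [hGdef, _root_.smul_apply, _root_.sub_apply, smul_eq_mul]
    field_simp
    ring
  have hGw : ∀ w, Tendsto (fun t => G t w) (𝓝[>] 0) (𝓝 (D₂ x₀ y w)) := fun w =>
    ((ContinuousLinearMap.apply ℝ ℝ w).continuous.tendsto _).comp hG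
  have hid : Tendsto (fun t : ℝ => t) (𝓝[>] 0) (𝓝 0) := nhdsWithin_le_nhds
  have hbound : ∀ᶠ t : ℝ in 𝓝[>] 0, 0 < t ∧ |D₁ x₀ τ + t * (G t τ -
      inner ℝ q y * (D₁ x₀ ν + t * G t ν))| ≤ t * (A * inner ℝ ν y) := by
    filter_upwards [hy, self_mem_nhdsWithin] with t ht ht0
    have ht0' : (0 : ℝ) < t := ht0
    have := hA _ ht
    rw [shearField, add_sub_cancel_left, inner_smul_right, inner_smul_right, map_sub, map_smul,
      hGe t ht0', hGe t ht0', smul_eq_mul] at this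
    refine ⟨ht0', ?_⟩
    convert this using 1
    · congr 1; ring
    · ring
  have hlim1 : Tendsto (fun t => G t τ - inner ℝ q y * (D₁ x₀ ν + t * G t ν)) (𝓝[>] 0)
      (𝓝 (D₂ x₀ y τ - inner ℝ q y * D₁ x₀ ν)) := by
    have := (hGw τ).sub (((hid.mul (hGw ν)).const_add (D₁ x₀ ν)).const_mul (inner ℝ q y))
    simpa using this
  have hzero : D₁ x₀ τ = 0 := by
    have hl : Tendsto (fun t => |D₁ x₀ τ + t * (G t τ - inner ℝ q y * (D₁ x₀ ν + t * G t ν))|)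
        (𝓝[>] 0) (𝓝 |D₁ x₀ τ|) := by
      have := ((hid.mul hlim1).const_add (D₁ x₀ τ)).abs
      simpa using this
    have hr : Tendsto (fun t => t * (A * inner ℝ ν y)) (𝓝[>] 0) (𝓝 0) := by
      simpa using hid.mul_const (A * inner ℝ ν y)
    have := le_of_tendsto_of_tendsto hl hr (hbound.mono fun t ht => ht.2)
    exact abs_nonpos_iff.1 this
  refine ⟨hzero, le_of_tendsto hlim1.abs (hbound.mono fun t ht => ?_)⟩
  have h2 := ht.2
  rw [hzero, zero_add, abs_mul, abs_of_pos ht.1] at h2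
  exact le_of_mul_le_mul_left h2 ht.1

/-- At the boundary, the tangential second derivatives of the solution are the product of the
normal derivative with the curvature of the boundary, and the mixed ones are bounded. -/
lemma boundary_two_apply (h : IsRegularSolution Ω f u D₁ D₂ lam K)
    {x₀ ν τ : EuclideanSpace ℝ (Fin n)} {ρ ρ₁ ρ₂} {δ N : ℝ} (hx₀ : x₀ ∈ closure Ω)
    (hδ : 0 < δ) (hc : IsBoundaryChart Ω x₀ ν ρ ρ₁ ρ₂ δ N) (hντ : inner ℝ ν τ = 0) {A : ℝ}
    (hA : ∀ x ∈ Ω, |D₁ x (shearField x₀ ν τ (bendVector (ρ₂ x₀) ν τ) x)| ≤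
      A * inner ℝ ν (x - x₀)) :
    D₁ x₀ τ = 0 ∧ |D₂ x₀ ν τ| ≤ A ∧ D₂ x₀ τ τ = ρ₂ x₀ τ τ * D₁ x₀ ν := by
  have hνν : inner ℝ ν ν = (1 : ℝ) := by rw [real_inner_self_eq_norm_sq, hc.norm_normal]; norm_num
  have hν := h.abs_two_apply_sub_le hx₀ (hc.eventually_mem hδ (y := ν) (by rw [hνν]; norm_num)) hA
  rw [inner_bendVector, hνν] at hν
  simp only [mul_one, sub_self, zero_mul, sub_zero] at hν
  refine ⟨hν.1, hν.2, ?_⟩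
  have hη : ∀ η : ℝ, 0 < η →
      |D₂ x₀ τ τ - ρ₂ x₀ τ τ * D₁ x₀ ν + η * D₂ x₀ ν τ| ≤ η * A := by
    intro η hη
    have hin : inner ℝ ν (τ + η • ν) = η := by
      rw [inner_add_right, inner_smul_right, hντ, hνν]; ring
    have := (h.abs_two_apply_sub_le hx₀
      (hc.eventually_mem hδ (y := τ + η • ν) (by rw [hin]; exact hη)) hA).2
    rw [hin, inner_bendVector, hin] at this
    simp only [map_add, map_smul, _root_.add_apply, _root_.smul_apply, smul_eq_mul] at this
    convert this using 1
    · congr 1; ring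
    · ring
  have hlim : Tendsto (fun η : ℝ => |D₂ x₀ τ τ - ρ₂ x₀ τ τ * D₁ x₀ ν + η * D₂ x₀ ν τ|) (𝓝[>] 0)
      (𝓝 |D₂ x₀ τ τ - ρ₂ x₀ τ τ * D₁ x₀ ν|) := by
    have : Continuous fun η : ℝ => |D₂ x₀ τ τ - ρ₂ x₀ τ τ * D₁ x₀ ν + η * D₂ x₀ ν τ| := by fun_prop
    simpa using (this.tendsto 0).mono_left (nhdsWithin_le_nhds (s := Ioi 0))
  have hlim' : Tendsto (fun η : ℝ => η * A) (𝓝[>] 0) (𝓝 0) := by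
    have : Continuous fun η : ℝ => η * A := by fun_prop
    simpa using (this.tendsto 0).mono_left (nhdsWithin_le_nhds (s := Ioi 0))
  have := le_of_tendsto_of_tendsto hlim hlim'
    (eventually_mem_nhdsWithin.mono fun η h0 => hη η h0)
  linarith [abs_nonpos_iff.1 this]

/-- The second derivatives are bounded at the boundary, with a uniform constant. -/
lemma exists_boundary_bound [NeZero n] (hΩ : IsOpen Ω) (hne : Ω.Nonempty)
    (hb : Bornology.IsBounded Ω) (hlam : 0 < lam) (K : ℝ) {δ N R d : ℝ} (hδ : 0 < δ) (hN : 0 < N)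
    (hR : 0 < R) (hd : 0 < d) (hdiam : ∀ x ∈ closure Ω, ∀ y ∈ closure Ω, ‖x - y‖ ≤ d)
    (hchart : ∀ x₀ ∈ frontier Ω, ∃ ν ρ ρ₁ ρ₂, IsBoundaryChart Ω x₀ ν ρ ρ₁ ρ₂ δ N ∧
      Ω ⊆ ball (x₀ + R • ν) R) :
    ∃ C : ℝ, 0 < C ∧ ∀ f u D₁ D₂, IsRegularSolution Ω f u D₁ D₂ lam K →
      ∀ x₀ ∈ frontier Ω, ∀ e, D₂ x₀ e e ≤ C * ‖e‖ ^ 2 := by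
  obtain ⟨A, hA0, hA⟩ := exists_apply_shearField_le hΩ hb hlam K hδ hN hR hd.le hdiam
    fun y hy => by
      obtain ⟨ν, ρ, ρ₁, ρ₂, hc, hsub⟩ := hchart y hy
      exact ⟨ν, hc.norm_normal, hsub⟩
  obtain ⟨p, hp⟩ := hne
  obtain ⟨r, hr, hpr⟩ := nhds_basis_closedBall.mem_iff.1 (hΩ.mem_nhds hp)
  set L : ℝ := 2 * R / lam with hL
  set c₁ : ℝ := lam / 4 * r ^ 2 / d with hc₁
  set c : ℝ := c₁ / R with hc
  have hLpos : 0 < L := by positivity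
  have hc₁pos : 0 < c₁ := by positivity
  have hcpos : 0 < c := by positivity
  refine ⟨2 * (N * L + (2 * A ^ 2 / c + 1 / lam / (c / 2) ^ n * (c / 2))), by positivity, ?_⟩
  intro f u D₁ D₂ h x₀ hx₀ e
  obtain ⟨ν, ρ, ρ₁, ρ₂, hch, hsub⟩ := hchart x₀ hx₀
  have hx₀c : x₀ ∈ closure Ω := frontier_subset_closure hx₀
  have hνν : inner ℝ ν ν = (1 : ℝ) := by rw [real_inner_self_eq_norm_sq, hch.norm_normal]; norm_num
  have hAabs : ∀ τ, ‖τ‖ = 1 → inner ℝ ν τ = 0 → ∀ x ∈ Ω,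
      |D₁ x (shearField x₀ ν τ (bendVector (ρ₂ x₀) ν τ) x)| ≤ A * inner ℝ ν (x - x₀) := by
    intro τ hτ hντ x hx
    refine abs_le.2 ⟨?_, hA f u D₁ D₂ h x₀ hx₀ ν ρ ρ₁ ρ₂ hch hsub τ hτ hντ x hx⟩
    have := hA f u D₁ D₂ h x₀ hx₀ ν ρ ρ₁ ρ₂ hch hsub (-τ) (by rwa [norm_neg])
      (by rw [inner_neg_right, hντ, neg_zero]) x hx
    have e : shearField x₀ ν (-τ) (bendVector (ρ₂ x₀) ν (-τ)) x =
        -shearField x₀ ν τ (bendVector (ρ₂ x₀) ν τ) x := by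
      rw [shearField, shearField, bendVector_neg, inner_neg_left]
      module
    rw [e, map_neg] at this
    linarith
  have hbd : ∀ τ, ‖τ‖ = 1 → inner ℝ ν τ = 0 → _ := fun τ hτ hντ =>
    h.boundary_two_apply hx₀c hδ hch hντ (hAabs τ hτ hντ)
  have hux₀ : u x₀ = 0 := h.eq_zero x₀ hx₀
  -- the normal derivative is bounded, and bounded away from zero
  have hDν_low : -L ≤ D₁ x₀ ν := by
    have hin := hch.eventually_mem hδ (y := ν) (by rw [hνν]; norm_num)
    have hlim := (h.hasD₁ x₀ hx₀c).tendsto_ray (hin.mono fun t ht => subset_closure ht)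
    refine ge_of_tendsto hlim ?_
    filter_upwards [hin, self_mem_nhdsWithin] with t ht ht0
    have ht0' : (0 : ℝ) < t := ht0
    have := h.neg_le_mul_norm_sub hΩ hb hlam hch.norm_normal hR hsub (subset_closure ht)
    rw [add_sub_cancel_left, norm_smul, hch.norm_normal, Real.norm_of_nonneg ht0'.le] at this
    rw [hux₀, smul_eq_mul, sub_zero, le_inv_mul_iff₀ ht0']
    linarith
  have hDν_up : D₁ x₀ ν ≤ -c₁ := by
    have h1 := h.apply_sub_le hx₀c (subset_closure hp)
    have h2 := h.le_of_closedBall_subset hΩ hb hlam hr hpr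
    set s : ℝ := inner ℝ ν (p - x₀) with hs
    set σ := p - x₀ - s • ν with hσ
    have hσν : inner ℝ ν σ = 0 := by rw [hσ, inner_sub_right, inner_smul_right, hνν]; ring
    have hσ0 : D₁ x₀ σ = 0 := by
      by_cases h0 : σ = 0
      · simp [h0]
      have hpos : ‖σ‖ ≠ 0 := norm_ne_zero_iff.2 h0
      have := (hbd (‖σ‖⁻¹ • σ) (by rw [norm_smul, norm_inv, norm_norm, inv_mul_cancel₀ hpos])
        (by rw [inner_smul_right, hσν, mul_zero])).1
      rw [map_smul, smul_eq_mul] at this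
      exact (mul_eq_zero.1 this).resolve_left (inv_ne_zero hpos)
    have hpx : p - x₀ = σ + s • ν := by rw [hσ]; abel
    rw [hpx, map_add, map_smul, hσ0, smul_eq_mul, hux₀] at h1
    have hsd : s ≤ d := by
      have := real_inner_le_norm ν (p - x₀)
      rw [hch.norm_normal, one_mul] at this
      exact this.trans (hdiam p (subset_closure hp) x₀ hx₀c)
    have hs0 : 0 ≤ s := by
      have := sq_norm_sub_le_of_subset_ball hch.norm_normal hR hsub (subset_closure hp)
      by_contra! hneg
      nlinarith [sq_nonneg ‖p - x₀‖]
    by_contra! hcon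
    have h3 : c₁ * d = lam / 4 * r ^ 2 := by rw [hc₁]; field_simp
    have h4 : 0 < lam / 4 * r ^ 2 := by positivity
    have hs1 : 0 < s := by
      rcases hs0.eq_or_lt with h0 | h0
      · rw [← h0] at h1; linarith
      · exact h0
    nlinarith
  have hρN : ∀ τ, ‖τ‖ = 1 → -N ≤ ρ₂ x₀ τ τ := fun τ hτ => by
    have := (ρ₂ x₀).le_opNorm₂ τ τ
    rw [hτ, mul_one, mul_one] at this
    exact (abs_le.1 (this.trans (hch.norm_two_le x₀ (mem_ball_self hδ)))).1
  refine apply_self_le_of_det_le (h.symm x₀ hx₀c) (h.nonneg hΩ hx₀c) hch.norm_normal hcpos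
    (by positivity) (by positivity) ?_ ?_ (fun τ hτ hντ => (hbd τ hτ hντ).2.1) (h.det_le hx₀c) e
  · intro τ hτ hντ
    rw [(hbd τ hτ hντ).2.2]
    have h1 := hch.two_apply_le hδ hN hR hsub hτ hντ
    have h2 : 0 < 1 / R := by positivity
    have h3 : c = 1 / R * c₁ := by rw [hc]; ring
    rw [h3]
    nlinarith
  · intro τ hτ hντ
    rw [(hbd τ hτ hντ).2.2]
    have h1 := hρN τ hτ
    nlinarith

end IsRegularSolution

end

/-! ### Second derivatives in the interior -/

section
open Filter Topology Set Metric
variable {n : ℕ}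

namespace IsRegularSolution
variable {Ω : Set (EuclideanSpace ℝ (Fin n))} {f u : EuclideanSpace ℝ (Fin n) → ℝ}
  {D₁ : EuclideanSpace ℝ (Fin n) → EuclideanSpace ℝ (Fin n) →L[ℝ] ℝ}
  {D₂ : EuclideanSpace ℝ (Fin n) →
      EuclideanSpace ℝ (Fin n) →L[ℝ] EuclideanSpace ℝ (Fin n) →L[ℝ] ℝ} {lam K : ℝ}

/-- Where a symmetric second difference of `u`, plus a paraboloid, has an interior local maximum,
the opening of the paraboloid is bounded. This is the log-concavity of the determinant. -/
lemma opening_le_of_isMax_second_difference [NeZero n] (h : IsRegularSolution Ω f u D₁ D₂ lam K)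
    (hΩ : IsOpen Ω) (hlam : 0 < lam) {p y v : EuclideanSpace ℝ (Fin n)} {a : ℝ} (ha : 0 ≤ a)
    (hy : y ∈ Ω) (hyv : y + v ∈ Ω) (hyv' : y - v ∈ Ω) {D : Set (EuclideanSpace ℝ (Fin n))}
    (hD : D ∈ 𝓝 y)
    (hmax : ∀ x ∈ D, u (x + v) + u (x - v) - 2 * u x + a * ‖x - p‖ ^ 2 ≤
      u (y + v) + u (y - v) - 2 * u y + a * ‖y - p‖ ^ 2) :
    2 * a * lam ^ 3 ≤ (|K| / lam + K ^ 2) * ‖v‖ ^ 2 := by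
  have hquad : ∀ w : EuclideanSpace ℝ (Fin n),
      2⁻¹ * (D₂ (y + v) w w + D₂ (y - v) w w) + a * ‖w‖ ^ 2 ≤ D₂ y w w := by
    intro w
    have h1 := (h.hasSecondDifference hΩ hyv w).comp_affine (x := y) (v := w)
      (F := fun x => x + v) fun s => by abel
    have h2 := (h.hasSecondDifference hΩ hyv' w).comp_affine (x := y) (v := w)
      (F := fun x => x - v) fun s => by abel
    have := (((h1.add h2).sub ((h.hasSecondDifference hΩ hy w).const_mul 2)).add
      ((HasSecondDifference.sq_norm_sub p y w).const_mul a)).nonpos_of_isMax hD hmax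
    linarith
  have hp₁ := h.posDef hΩ hlam hyv
  have hp₂ := h.posDef hΩ hlam hyv'
  set P := (2⁻¹ : ℝ) • (formMatrix (D₂ (y + v)) + formMatrix (D₂ (y - v))) with hP
  have hPpos : P.PosDef := (hp₁.add hp₂).smul (by norm_num)
  have hmain := h.det_mul_le hΩ hlam hy hPpos ha fun w => by
    rw [hP, Matrix.smul_mulVec, Matrix.add_mulVec, dotProduct_smul, dotProduct_add,
      dotProduct_formMatrix_mulVec, dotProduct_formMatrix_mulVec, smul_eq_mul]
    exact hquad _
  have hconc := hp₁.det_mul_det_le_sq_det_midpoint hp₂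
  rw [h.det_eq _ hyv, h.det_eq _ hyv', ← hP] at hconc
  have hs := h.second_diff y v hy hyv hyv'
  have hl₁ := h.lip _ hyv _ hyv'
  have hl₂ := h.lip _ hyv' _ hyv
  have e1 : y + v - (y - v) = (2 : ℝ) • v := by module
  have e2 : y - v - (y + v) = -((2 : ℝ) • v) := by module
  rw [e1, norm_smul, Real.norm_two] at hl₁
  rw [e2, norm_neg, norm_smul, Real.norm_two] at hl₂
  have b0 := h.lower y hy
  have b0' := h.upper y hy
  have b1 := h.lower _ hyv
  have b2 := h.lower _ hyv'
  set F := f y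
  set F₁ := f (y + v)
  set F₂ := f (y - v)
  set N := ‖v‖
  have hN : 0 ≤ N := norm_nonneg v
  -- the product of the two values of `f` differs from `f²` by a term of second order
  have hdiff : ((F₁ - F₂) / 2) ^ 2 ≤ K ^ 2 * N ^ 2 := by
    have : |(F₁ - F₂) / 2| ≤ |K| * N := by
      have hK : K * (2 * N) ≤ |K| * (2 * N) :=
        mul_le_mul_of_nonneg_right (le_abs_self K) (by positivity)
      rw [abs_le]
      constructor <;> linarith
    have h2 := pow_le_pow_left₀ (abs_nonneg _) this 2
    rwa [sq_abs, mul_pow, sq_abs] at h2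
  have hmid : F ^ 2 - |K| / lam * N ^ 2 ≤ ((F₁ + F₂) / 2) ^ 2 := by
    have h1 : 2 * F - (F₁ + F₂) ≤ |K| * N ^ 2 :=
      hs.trans (mul_le_mul_of_nonneg_right (le_abs_self K) (sq_nonneg N))
    have h2 : F * (2 * F - (F₁ + F₂)) ≤ 1 / lam * (|K| * N ^ 2) :=
      (mul_le_mul_of_nonneg_left h1 (by linarith)).trans
        (mul_le_mul_of_nonneg_right b0' (by positivity))
    have h3 : 1 / lam * (|K| * N ^ 2) = |K| / lam * N ^ 2 := by ring
    have h4 := sq_nonneg ((F₁ + F₂) / 2 - F)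
    have h5 : ((F₁ + F₂) / 2 - F) ^ 2 =
      ((F₁ + F₂) / 2) ^ 2 - F ^ 2 + F * (2 * F - (F₁ + F₂)) := by ring
    linarith
  have hprod : F ^ 2 - (|K| / lam + K ^ 2) * N ^ 2 ≤ F₁ * F₂ := by
    have : F₁ * F₂ = ((F₁ + F₂) / 2) ^ 2 - ((F₁ - F₂) / 2) ^ 2 := by ring
    linarith
  have hPd := hPpos.det_pos
  have hsq : P.det ^ 2 * (1 + 2 * (a * lam)) ≤ F ^ 2 := by
    have h1 : (P.det * (1 + a * lam)) ^ 2 ≤ F ^ 2 := pow_le_pow_left₀ (by positivity) hmain 2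
    have h2 : 0 ≤ P.det ^ 2 * (a * lam) ^ 2 := by positivity
    have h3 : (P.det * (1 + a * lam)) ^ 2 =
      P.det ^ 2 * (1 + 2 * (a * lam)) + P.det ^ 2 * (a * lam) ^ 2 := by ring
    linarith
  have hll : lam ^ 2 ≤ F₁ * F₂ := by
    rw [sq]; exact mul_le_mul b1 b2 hlam.le (hlam.le.trans b1)
  have h6 : lam ^ 2 * (2 * (a * lam)) ≤ P.det ^ 2 * (2 * (a * lam)) :=
    mul_le_mul_of_nonneg_right (hll.trans hconc) (by positivity)
  linarith

/-- A bound for the second derivatives at the boundary propagates to the interior. -/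
lemma two_apply_le [NeZero n] (h : IsRegularSolution Ω f u D₁ D₂ lam K) (hΩ : IsOpen Ω)
    (hb : Bornology.IsBounded Ω) (hlam : 0 < lam) {d C : ℝ}
    (hdiam : ∀ x ∈ closure Ω, ∀ y ∈ closure Ω, ‖x - y‖ ≤ d)
    (hbdry : ∀ x₀ ∈ frontier Ω, ∀ e, D₂ x₀ e e ≤ C * ‖e‖ ^ 2)
    {x e : EuclideanSpace ℝ (Fin n)} (hx : x ∈ Ω) (he : ‖e‖ = 1) :
    D₂ x e e ≤ C + 2 + ((|K| / lam + K ^ 2) / lam ^ 3 + 1) * d ^ 2 := by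
  set M : ℝ := (|K| / lam + K ^ 2) / lam ^ 3 + 1 with hM
  have hMpos : 0 < M := by positivity
  have hcomp : IsCompact (closure Ω) := hb.isCompact_closure
  obtain ⟨η, hη, hunif⟩ := Metric.uniformContinuousOn_iff.1
    (hcomp.uniformContinuousOn_of_continuous h.cont) 1 one_pos
  refine le_of_tendsto (h.hasSecondDifference hΩ hx e) ?_
  have h1 : ∀ᶠ t : ℝ in 𝓝[>] 0, x + t • e ∈ Ω := by
    have : ContinuousAt (fun ε : ℝ => x + ε • e) 0 := by fun_prop
    exact mem_nhdsWithin_of_mem_nhds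
      (this (by simpa using hΩ.mem_nhds hx : Ω ∈ 𝓝 (x + (0 : ℝ) • e)))
  have h2 : ∀ᶠ t : ℝ in 𝓝[>] 0, x - t • e ∈ Ω := by
    have : ContinuousAt (fun ε : ℝ => x - ε • e) 0 := by fun_prop
    exact mem_nhdsWithin_of_mem_nhds
      (this (by simpa using hΩ.mem_nhds hx : Ω ∈ 𝓝 (x - (0 : ℝ) • e)))
  filter_upwards [h1, h2, self_mem_nhdsWithin,
    mem_nhdsWithin_of_mem_nhds (Iio_mem_nhds (half_pos hη))] with t ht1 ht2 ht0 htη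
  have ht0' : (0 : ℝ) < t := ht0
  have htη' : t < η / 2 := htη
  set v := t • e with hv
  have hvn : ‖v‖ = t := by rw [hv, norm_smul, he, mul_one, Real.norm_of_nonneg ht0'.le]
  have hc1 : Continuous fun z : EuclideanSpace ℝ (Fin n) => z + v := by fun_prop
  have hc2 : Continuous fun z : EuclideanSpace ℝ (Fin n) => z - v := by fun_prop
  set D := closure Ω ∩ ((fun z => z + v) ⁻¹' closure Ω ∩ (fun z => z - v) ⁻¹' closure Ω) with hD
  have hDc : IsCompact D := hcomp.inter_right
    ((isClosed_closure.preimage hc1).inter (isClosed_closure.preimage hc2))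
  have hxD : x ∈ D := ⟨subset_closure hx, subset_closure ht1, subset_closure ht2⟩
  obtain ⟨y, hyD, hmax⟩ := hDc.exists_isMaxOn ⟨x, hxD⟩
    (f := fun z => u (z + v) + u (z - v) - 2 * u z + t ^ 2 * M * ‖z - x‖ ^ 2)
    ((((h.continuousOn.comp hc1.continuousOn fun z hz => hz.2.1).add
      (h.continuousOn.comp hc2.continuousOn fun z hz => hz.2.2)).sub
      (continuousOn_const.mul (h.continuousOn.mono inter_subset_left))).add
      (by fun_prop : Continuous fun z => t ^ 2 * M * ‖z - x‖ ^ 2).continuousOn)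
  -- a maximum point has to be within `t` of the boundary
  have hnear : ∃ z ∈ frontier Ω, ‖y - z‖ ≤ t := by
    have hfront : ∀ z ∈ closure Ω, z ∉ Ω → z ∈ frontier Ω := fun z hz hzΩ => by
      rw [hΩ.frontier_eq]; exact ⟨hz, hzΩ⟩
    by_cases hy : y ∈ Ω
    swap
    · exact ⟨y, hfront y hyD.1 hy, by simpa using ht0'.le⟩
    by_cases hy1 : y + v ∈ Ω
    swap
    · exact ⟨y + v, hfront _ hyD.2.1 hy1, by simp [hvn]⟩
    by_cases hy2 : y - v ∈ Ω
    swap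
    · exact ⟨y - v, hfront _ hyD.2.2 hy2, by simp [hvn]⟩
    exfalso
    have hDn : D ∈ 𝓝 y := mem_of_superset
      ((hΩ.inter ((hΩ.preimage hc1).inter (hΩ.preimage hc2))).mem_nhds ⟨hy, hy1, hy2⟩)
      (inter_subset_inter subset_closure (inter_subset_inter (preimage_mono subset_closure)
        (preimage_mono subset_closure)))
    have := h.opening_le_of_isMax_second_difference hΩ hlam (by positivity) hy hy1 hy2 hDn hmax
    rw [hvn] at this
    have e1 : 2 * (t ^ 2 * M) * lam ^ 3 =
        2 * ((|K| / lam + K ^ 2) * t ^ 2) + 2 * (t ^ 2 * lam ^ 3) := by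
      rw [hM]; field_simp
    have e2 : 0 ≤ (|K| / lam + K ^ 2) * t ^ 2 := by positivity
    have e3 : 0 < t ^ 2 * lam ^ 3 := by positivity
    linarith
  obtain ⟨z, hz, hyz⟩ := hnear
  have hzc : z ∈ closure Ω := frontier_subset_closure hz
  have hsd := abs_second_difference_sub_le h.convexOn.1 h.hasD₁ h.hasD₂ hyD.1 hyD.2.1 hyD.2.2
    (B := D₂ z) (ε := 1) fun z' hz' hd => by
      have hlt : dist z' z < η := by
        rw [dist_eq_norm]
        have e : z' - z = (z' - y) + (y - z) := by abel
        rw [e]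
        refine (norm_add_le _ _).trans_lt ?_
        rw [hvn] at hd
        linarith
      exact (dist_eq_norm (D₂ z') (D₂ z)).symm.trans_le (hunif z' hz' z hzc hlt).le
  have hbz := hbdry z hz v
  rw [hvn] at hsd hbz
  have hmx : u (x + v) + u (x - v) - 2 * u x + t ^ 2 * M * ‖x - x‖ ^ 2 ≤
    u (y + v) + u (y - v) - 2 * u y + t ^ 2 * M * ‖y - x‖ ^ 2 := hmax hxD
  have hyx : t ^ 2 * M * ‖y - x‖ ^ 2 ≤ t ^ 2 * M * d ^ 2 := by
    gcongr
    exact hdiam y hyD.1 x (subset_closure hx)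
  rw [sub_self x, norm_zero] at hmx
  have := (abs_le.1 hsd).2
  rw [div_le_iff₀ (by positivity)]
  linarith

end IsRegularSolution

/-! ### The global bound -/

lemma norm_le_of_apply_self_le {E : Type*} [NormedAddCommGroup E] [NormedSpace ℝ E]
    {B : E →L[ℝ] E →L[ℝ] ℝ} (hsymm : ∀ v w, B v w = B w v) (hnonneg : ∀ v, 0 ≤ B v v) {C : ℝ}
    (hC : 0 ≤ C) (hle : ∀ e, ‖e‖ = 1 → B e e ≤ C) : ‖B‖ ≤ C := by
  refine ContinuousLinearMap.opNorm_le_of_unit_norm hC fun v hv =>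
    ContinuousLinearMap.opNorm_le_of_unit_norm hC fun w hw => ?_
  have h1 := hnonneg (v + w)
  have h2 := hnonneg (v - w)
  simp only [map_add, map_sub, _root_.add_apply, _root_.sub_apply, hsymm w v] at h1 h2
  have h3 := hle v hv
  have h4 := hle w hw
  rw [Real.norm_eq_abs, abs_le]
  constructor <;> linarith

lemma norm_iteratedFDerivWithin_two {E : Type*} [NormedAddCommGroup E] [NormedSpace ℝ E]
    {S : Set E} (hS : UniqueDiffOn ℝ S) {x : E} (hx : x ∈ S) (g : E → ℝ) :
    ‖iteratedFDerivWithin ℝ 2 g S x‖ = ‖fderivWithin ℝ (fderivWithin ℝ g S) S x‖ := by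
  rw [← norm_iteratedFDerivWithin_fderivWithin hS hx, norm_iteratedFDerivWithin_one _ (hS x hx)]

lemma norm_iteratedFDerivWithin_le_of_supNormDeriv_le {Ω : Set (EuclideanSpace ℝ (Fin n))}
    {g : EuclideanSpace ℝ (Fin n) → ℝ} {k : ℕ} {K : ℝ}
    (h : supNormDeriv k Ω g ≤ ENNReal.ofReal K) {x : EuclideanSpace ℝ (Fin n)}
    (hx : x ∈ closure Ω) : ‖iteratedFDerivWithin ℝ k g (closure Ω) x‖ ≤ max K 0 := by
  have h1 : ‖iteratedFDerivWithin ℝ k g (closure Ω) x‖ₑ ≤ ENNReal.ofReal K :=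
    (le_iSup₂ (f := fun x (_ : x ∈ closure Ω) =>
      ‖iteratedFDerivWithin ℝ k g (closure Ω) x‖ₑ) x hx).trans h
  have h2 := ENNReal.toReal_mono ENNReal.ofReal_ne_top h1
  rwa [toReal_enorm, ENNReal.toReal_ofReal'] at h2

lemma hessianMatrix_eq_formMatrix {Ω : Set (EuclideanSpace ℝ (Fin n))} (hΩ : IsOpen Ω)
    (u : EuclideanSpace ℝ (Fin n) → ℝ) {x : EuclideanSpace ℝ (Fin n)} (hx : x ∈ Ω) :
    hessianMatrix u x =
      formMatrix (fderivWithin ℝ (fderivWithin ℝ u (closure Ω)) (closure Ω) x) := by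
  have h1 : fderivWithin ℝ u (closure Ω) =ᶠ[𝓝 x] fderiv ℝ u := by
    filter_upwards [hΩ.mem_nhds hx] with y hy
    exact fderivWithin_of_mem_nhds (IsRegularSolution.closure_mem_nhds hΩ hy)
  rw [fderivWithin_of_mem_nhds (IsRegularSolution.closure_mem_nhds hΩ hx), h1.fderiv_eq]
  ext i j
  simp [hessianMatrix, formMatrix, iteratedFDeriv_two_apply]

lemma IsMongeAmpereSolution.isRegularSolution {Ω : Set (EuclideanSpace ℝ (Fin n))}
    (hΩ : IsOpen Ω) (hne : Ω.Nonempty) {lam K : ℝ} {f u : EuclideanSpace ℝ (Fin n) → ℝ}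
    (hf : ContDiffOn ℝ 2 f (closure Ω)) (hfl : ∀ x ∈ Ω, lam ≤ f x ∧ f x ≤ 1 / lam)
    (hfK : normC2 Ω f ≤ ENNReal.ofReal K) (hu : IsMongeAmpereSolution Ω f u) :
    IsRegularSolution Ω f u (fderivWithin ℝ u (closure Ω))
      (fderivWithin ℝ (fderivWithin ℝ u (closure Ω)) (closure Ω)) lam (2 * max K 0) := by
  have hconv := hu.convexOn.1
  have hsub : Ω ⊆ interior (closure Ω) := hΩ.subset_interior_closure
  have hS : UniqueDiffOn ℝ (closure Ω) := uniqueDiffOn_convex hconv (hne.mono hsub)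
  have hu1 : ContDiffOn ℝ 1 (fderivWithin ℝ u (closure Ω)) (closure Ω) :=
    hu.contDiffOn.fderivWithin hS (by norm_num)
  have hf1 : ContDiffOn ℝ 1 (fderivWithin ℝ f (closure Ω)) (closure Ω) :=
    hf.fderivWithin hS (by norm_num)
  have hfd1 : ∀ x ∈ closure Ω,
      HasFDerivWithinAt f (fderivWithin ℝ f (closure Ω) x) (closure Ω) x := fun x hx =>
    (hf.differentiableOn (by norm_num) x hx).hasFDerivWithinAt
  have hfd2 : ∀ x ∈ closure Ω, HasFDerivWithinAt (fderivWithin ℝ f (closure Ω))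
      (fderivWithin ℝ (fderivWithin ℝ f (closure Ω)) (closure Ω) x) (closure Ω) x := fun x hx =>
    (hf1.differentiableOn (by norm_num) x hx).hasFDerivWithinAt
  have hK1 : supNormDeriv 1 Ω f ≤ ENNReal.ofReal K :=
    (le_add_self.trans le_self_add).trans hfK
  have hK2 : supNormDeriv 2 Ω f ≤ ENNReal.ofReal K := le_add_self.trans hfK
  have hK0 : 0 ≤ max K 0 := le_max_right _ _
  refine ⟨hu.convexOn, fun x hx => (hu.contDiffOn.differentiableOn (by norm_num) x
    hx).hasFDerivWithinAt, fun x hx => (hu1.differentiableOn (by norm_num) x hx).hasFDerivWithinAt,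
    hu1.continuousOn_fderivWithin hS le_rfl, fun x hx v w => ?_, fun x hx => ?_, hu.eq_zero,
    fun x hx => (hfl x hx).1, fun x hx => (hfl x hx).2, fun x hx y hy => ?_,
    fun x v hx hxv hxv' => ?_⟩
  · exact (hu.contDiffOn x hx).isSymmSndFDerivWithinAt (by simp) hS (closure_mono hsub hx) hx v w
  · rw [← hessianMatrix_eq_formMatrix hΩ u hx, hu.det_eq x hx]
  · have := hconv.norm_image_sub_le_of_norm_hasFDerivWithin_le hfd1 (C := max K 0) (fun z hz => by
      rw [← norm_iteratedFDerivWithin_one _ (hS z hz)]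
      exact norm_iteratedFDerivWithin_le_of_supNormDeriv_le hK1 hz)
      (subset_closure hy) (subset_closure hx)
    refine (le_abs_self _).trans (this.trans ?_)
    gcongr
    linarith
  · have := abs_second_difference_sub_le hconv hfd1 hfd2 (subset_closure hx) (subset_closure hxv)
      (subset_closure hxv') (B := 0) (ε := max K 0) fun z hz _ => by
        rw [sub_zero, ← norm_iteratedFDerivWithin_two hS hz]
        exact norm_iteratedFDerivWithin_le_of_supNormDeriv_le hK2 hz
    have h2 := (abs_le.1 this).1
    simp only [_root_.zero_apply, sub_zero] at h2
    linarith

end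

theorem mainTheorem4 {n : ℕ} (Ω : Set (EuclideanSpace ℝ (Fin n)))
    (hΩ_open : IsOpen Ω) (hΩ_conn : IsConnected Ω) (hΩ_bdd : Bornology.IsBounded Ω)
    (hΩ_C3 : IsOfClassC 3 Ω) (hΩ_uc : IsUniformlyConvexDomain Ω)
    (lam : ℝ) (hlam : 0 < lam) (K : ℝ) :
    ∃ C : ℝ, ∀ f u : EuclideanSpace ℝ (Fin n) → ℝ,
      ContDiffOn ℝ 2 f (closure Ω) →
      (∀ x ∈ Ω, lam ≤ f x ∧ f x ≤ 1 / lam) →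
      normC2 Ω f ≤ ENNReal.ofReal K →
      IsMongeAmpereSolution Ω f u →
      supNormDeriv 2 Ω u ≤ ENNReal.ofReal C := by
  -- in dimension zero there is nothing to bound
  obtain rfl | hn := eq_or_ne n 0
  · refine ⟨0, fun f u _ _ _ _ => iSup₂_le fun x _ => ?_⟩
    have : iteratedFDerivWithin ℝ 2 u (closure Ω) x = 0 := by
      ext m
      exact ContinuousMultilinearMap.map_coord_zero _ 0 (Subsingleton.elim _ _)
    rw [this, enorm_zero]
    exact zero_le
  have : NeZero n := ⟨hn⟩
  have hne := hΩ_conn.nonempty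
  obtain ⟨δ, N, hδ, hN, hcharts⟩ := exists_uniform_charts hΩ_open hΩ_bdd hΩ_C3
  obtain ⟨R, hR, hball⟩ := hΩ_uc
  obtain ⟨d₀, hd₀⟩ := Metric.isBounded_iff.1 hΩ_bdd.closure
  have hdiam : ∀ x ∈ closure Ω, ∀ y ∈ closure Ω, ‖x - y‖ ≤ max d₀ 1 := fun x hx y hy => by
    rw [← dist_eq_norm]; exact (hd₀ hx hy).trans (le_max_left _ _)
  obtain ⟨C, hC, hbdry⟩ := IsRegularSolution.exists_boundary_bound hΩ_open hne hΩ_bdd hlam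
    (2 * max K 0) hδ hN hR (lt_max_of_lt_right one_pos) hdiam fun x₀ hx₀ => by
      obtain ⟨ν, ρ, ρ₁, ρ₂, hν, hc⟩ := hcharts x₀ hx₀
      exact ⟨ν, ρ, ρ₁, ρ₂, hc, hball x₀ hx₀ ν hν⟩
  refine ⟨C + 2 + ((|2 * max K 0| / lam + (2 * max K 0) ^ 2) / lam ^ 3 + 1) * (max d₀ 1) ^ 2,
    fun f u hf hfl hfK hu => iSup₂_le fun x hx => ?_⟩
  have h := hu.isRegularSolution hΩ_open hne hf hfl hfK
  have hS : UniqueDiffOn ℝ (closure Ω) :=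
    uniqueDiffOn_convex hu.convexOn.1 (hne.mono hΩ_open.subset_interior_closure)
  rw [← ofReal_norm]
  refine ENNReal.ofReal_le_ofReal ?_
  rw [norm_iteratedFDerivWithin_two hS hx]
  refine norm_le_of_apply_self_le (h.symm x hx) (h.nonneg hΩ_open hx) (by positivity)
    fun e he => ?_
  by_cases hxΩ : x ∈ Ω
  · exact h.two_apply_le hΩ_open hΩ_bdd hlam hdiam (hbdry f u _ _ h) hxΩ he
  · have := hbdry f u _ _ h x (by rw [hΩ_open.frontier_eq]; exact ⟨hx, hxΩ⟩) e
    rw [he] at this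
    have h0 : 0 ≤ ((|2 * max K 0| / lam + (2 * max K 0) ^ 2) / lam ^ 3 + 1) * (max d₀ 1) ^ 2 := by
      positivity
    linarith
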